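/- Setting. Let $D$ be a finite oriented disk cellulated by triangles and squares whose edges are directed, so that each triangle has vertices $0,1,2$ and edges $e_{01},e_{12},e_{02}$ and each square has vertices $0,1,2,3$ and edges $e_{01},e_{13},e_{02},e_{23}$ ($e_{ij}$ directed from $i$ to $j$). A cell has sign $\sigma=+1$ if the orientation with boundary $e_{01}+e_{12}-e_{02}$, respectively $e_{01}+e_{13}-e_{02}-e_{23}$, is that of $D$, and $\sigma=-1$ otherwise. (Examples: branched triangulations, and the square lattice on a rectangle.) The boundary circle is divided into three sides, called $L_{rb}$, $L_b$, $L_r$ in the cyclic order of the positively oriented boundary (on a rectangle with all edges directed to the right and upwards: $L_{rb}$ is bottom and right, $L_b$ is the top, $L_r$ is the left). Each side has at least one edge; corners belong to both adjacent sides. Each edge $e$ carries three qubits, of colours $r,g,b$; the basis states $|a_r,a_g,a_b\rangle$ are labelled by $\{0,1\}$-valued 1-cochains, $Z^c_e=(-1)^{a_c(e)}$. For 1-cochains, $\int\alpha\cup\beta$ is the sum over cells of $\sigma\,\alpha(e_{01})\beta(e_{12})$ for triangles and $\sigma(\alpha(e_{01})\beta(e_{13})-\alpha(e_{02})\beta(e_{23}))$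 for squares; for a 0-cochain $u$, $(u\cup\alpha)(e)=u(\text{start of }e)\alpha(e)$ and $(\alpha\cup u)(e)=\alpha(e)u(\text{end of }e)$. With $\hat v$ the indicator cochain of a vertex $v$ and $\hat e$ that of an edge $e$, and all cup products in $\mathbb Z_2$-cochains, put $$S^r_{v}=\prod_{e\ni v}X^r_e\prod_{\int\hat v\cup\hat e'\cup\hat e''\ne0}CZ^{g,b}_{e',e''},\quad S^g_{v}=\prod_{e\ni v}X^g_e\prod_{\int\hat e''\cup\hat v\cup\hat e'\neq0}CZ^{b,r}_{e',e''},\quad S^b_{v}=\prod_{e\ni v}X^b_e\prod_{\int\hat e'\cup\hat e''\cup\hat v\neq0}CZ^{r,g}_{e',e''}.$$ The code space is the common $+1$ eigenspace of: the face operators $\prod_{e\in\partial f}Z^c_e$ for all faces $f$ and colours $c$; $Z^r_e$ for $e$ in $L_r$; $Z^b_e$ for $e$ in $L_b$; $Z^r_eZ^b_e$ and $Z^g_e$ for $e$ in $L_{rb}$; $S^r_v$ for $v\notin L_r\cup L_{rb}$; $S^g_v$ for $v\notin L_{rb}$; $S^b_v$ for $v\notin L_b\cup L_{rb}$; and $S^r_vS^b_v$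 for $v\in L_{rb}$, $v\notin L_r\cup L_b$. Let $\overline Z=\prod_{e\in L_{rb}}Z^r_e$. Let $U=WV$ with $V=\bigotimes_e \mathrm{CNOT}^{(r,g)}_e\mathrm{CNOT}^{(b,g)}_e$ (targets green) and $$W=\prod_{\text{triangles}}\big(\mathrm{CS}^{r,b}_{e_{01},e_{12}}\big)^{\sigma}\prod_{\text{squares}}\big(\mathrm{CS}^{r,b}_{e_{01},e_{13}}(\mathrm{CS}^{r,b}_{e_{02},e_{23}})^\dagger\big)^{\sigma}\prod_{e\in L_{rb}}(\mathrm T^r_e)^{-\sigma_e},$$ where $\mathrm T=\mathrm{diag}(1,e^{\pi i/4})$ and $\sigma_e=1$ if $e$ is directed along the positively oriented boundary, $-1$ otherwise (so on the square lattice described above every edge of $L_{rb}$ carries $\mathrm T^\dagger$). Theorem 2. $U$ is unitary and maps the code space onto itself. The code space is a single logical qubit: it has an orthonormal basis $|\overline 0\rangle,|\overline 1\rangle$ with $\overline Z|\overline m\rangle=(-1)^m|\overline m\rangle$, and $$U|\overline m\rangle=e^{-\pi i m/4}|\overline m\rangle\qquad(m=0,1),$$ i.e. $U$ implements the logical $\mathrm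 T^\dagger$ gate. -/

import Mathlib

namespace CliffordCode

noncomputable section

/-! ### Qubits and gates

Every edge carries three qubits, one for each colour.  A computational basis state is a triple of
`ZMod 2`-valued 1-cochains (the eigenvalues of the Pauli `Z` operators are `(-1) ^ a`). -/

/-- The three colours: red, green, blue. -/
inductive Color
  | r
  | g
  | b
  deriving DecidableEq

instance : Fintype Color := ⟨{.r, .g, .b}, by intro c; cases c <;> simp⟩

/-- Labels of computational basis states: a bit for each edge and each colour. -/
abbrev Config (E : Type*) := E → Color → ZMod 2

/-- The Hilbert space of three qubits on each edge. -/
abbrev Hilb (E : Type*) [Fintype E] [DecidableEq E] := EuclideanSpace ℂ (Config E)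

/-- The operator `|a⟩ ↦ f a • |a⟩`, diagonal in the computational basis.  Diagonal gates are
represented by their functions `f` of eigenvalues, so that a product of such gates is a product of
functions. -/
def diagOp {E : Type*} [Fintype E] [DecidableEq E] (f : Config E → ℂ) : Hilb E →ₗ[ℂ] Hilb E where
  toFun ψ := WithLp.toLp 2 (fun a => f a * ψ a)
  map_add' ψ φ := by
    ext a
    simp [mul_add]
  map_smul' z ψ := by
    ext a
    simp [mul_left_comm]

/-- The operator `|a⟩ ↦ |σ a⟩` permuting the computational basis. -/
def permOp {E : Type*} [Fintype E] [DecidableEq E] (σ : Equiv.Perm (Config E)) :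
    Hilb E →ₗ[ℂ] Hilb E where
  toFun ψ := WithLp.toLp 2 (fun a => ψ (σ.symm a))
  map_add' ψ φ := by
    ext a
    simp
  map_smul' z ψ := by
    ext a
    simp

/-- Pauli `Z` on the qubit of colour `c` at the edge `e`. -/
def zGate {E : Type*} (c : Color) (e : E) : Config E → ℂ :=
  fun a => if a e c = 1 then -1 else 1

/-- The `T` gate on the qubit of colour `c` at the edge `e`. -/
def tGate {E : Type*} (c : Color) (e : E) : Config E → ℂ :=
  fun a => if a e c = 1 then Complex.exp (Real.pi * Complex.I / 4) else 1

/-- Controlled-`Z` between the qubit `(e, c)` and the qubit `(e', c')`. -/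
def czGate {E : Type*} (c c' : Color) (e e' : E) : Config E → ℂ :=
  fun a => if a e c = 1 ∧ a e' c' = 1 then -1 else 1

/-- Controlled-`S` between the qubit `(e, c)` and the qubit `(e', c')`; its inverse is `CS†`. -/
def csGate {E : Type*} (c c' : Color) (e e' : E) : Config E → ℂ :=
  fun a => if a e c = 1 ∧ a e' c' = 1 then Complex.I else 1

/-- The product of the Pauli `X` operators over the qubits `(e, c)` with `s e c = 1`. -/
def xOp {E : Type*} [Fintype E] [DecidableEq E] (s : Config E) : Hilb E →ₗ[ℂ] Hilb E :=
  permOp (Equiv.addRight s)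

/-- `CNOT` on the three qubits of one edge, with control `c` and target `t`. -/
def cnot (c t : Color) (h : c ≠ t) : Equiv.Perm (Color → ZMod 2) :=
  Function.Involutive.toPerm (fun s => Function.update s t (s t + s c)) (by
    intro s
    have h2 : s c + s c = 0 := CharTwo.add_self_eq_zero _
    funext x
    by_cases hx : x = t
    · subst hx
      simp [h, add_assoc, h2]
    · simp [hx])

/-! ### The lattice -/

/-- A 2-cell with its edges.  Its vertices are labelled `0, 1, 2` (triangle) or `0, 1, 2, 3`
(square), and `eij` is an edge directed from vertex `i` to vertex `j`.  The sign `σ` is `1` if the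
orientation for which the boundary is `e01 + e12 - e02`, respectively `e01 + e13 - e02 - e23`, is
the orientation of the surface, and `-1` otherwise. -/
inductive Cell (E : Type*)
  | triangle (σ : ℤˣ) (e01 e12 e02 : E)
  | square (σ : ℤˣ) (e01 e13 e02 e23 : E)

namespace Cell

variable {V E : Type*}

/-- The edges of a cell. -/
def edges : Cell E → List E
  | triangle _ e01 e12 e02 => [e01, e12, e02]
  | square _ e01 e13 e02 e23 => [e01, e13, e02, e23]

/-- The cellular boundary of a cell, an integral 1-chain. -/
def boundary [DecidableEq E] : Cell E → (E → ℤ)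
  | triangle σ e01 e12 e02 =>
      (σ : ℤ) • (Pi.single e01 1 + Pi.single e12 1 - Pi.single e02 1)
  | square σ e01 e13 e02 e23 =>
      (σ : ℤ) • (Pi.single e01 1 + Pi.single e13 1 - Pi.single e02 1 - Pi.single e23 1)

/-- The directed edges of the cell fit together, and its vertices are distinct.  (For a triangle
distinctness of the vertices follows from the absence of loops.) -/
def WellFormed (src tgt : E → V) : Cell E → Prop
  | triangle _ e01 e12 e02 =>
      src e01 = src e02 ∧ tgt e01 = src e12 ∧ tgt e12 = tgt e02
  | square _ e01 e13 e02 e23 =>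
      src e01 = src e02 ∧ tgt e01 = src e13 ∧ tgt e02 = src e23 ∧ tgt e13 = tgt e23 ∧
        src e01 ≠ tgt e13 ∧ tgt e01 ≠ tgt e02

/-- The integral over a cell of the cup product of two 1-cochains. -/
def cup {R : Type*} [CommRing R] (α β : E → R) : Cell E → R
  | triangle σ e01 e12 _ => ((σ : ℤ) : R) * (α e01 * β e12)
  | square σ e01 e13 e02 e23 => ((σ : ℤ) : R) * (α e01 * β e13 - α e02 * β e23)

/-- The controlled-`S` gates of a cell between red and blue qubits. -/
def csGates : Cell E → (Config E → ℂ)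
  | triangle σ e01 e12 _ => csGate .r .b e01 e12 ^ (σ : ℤ)
  | square σ e01 e13 e02 e23 =>
      (csGate .r .b e01 e13 * (csGate .r .b e02 e23)⁻¹) ^ (σ : ℤ)

end Cell

/-- The three sides of the triangle, named after the boundary conditions
`L_r`, `L_b` and `L_rb`. -/
inductive Side
  | r
  | b
  | rb
  deriving DecidableEq

instance : Fintype Side := ⟨{.r, .b, .rb}, by intro A; cases A <;> simp⟩

/-- The cyclic order of the sides along the positively oriented boundary. -/
def Side.next : Side → Side
  | .rb => .b
  | .b => .r
  | .r => .rb

/-- A finite oriented disk, cellulated by triangles and squares with directed edges, whose boundary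
circle is divided into the three sides of a triangle. -/
structure TriangleLattice (V E F : Type*) [Fintype V] [Fintype E] [Fintype F] [DecidableEq E] where
  /-- The initial vertex of an edge. -/
  src : E → V
  /-- The final vertex of an edge. -/
  tgt : E → V
  /-- The 2-cells. -/
  cell : F → Cell E
  no_loop : ∀ e, src e ≠ tgt e
  wellFormed : ∀ f, (cell f).WellFormed src tgt
  /-- The number of edges of a side. -/
  len : Side → ℕ
  /-- The `i`-th vertex of a side, for `0 ≤ i ≤ len`, in the direction of the positively oriented
  boundary (values for larger `i` play no role). -/
  sideVertex : Side → ℕ → V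
  /-- The edge of a side between its `i`-th and `(i + 1)`-st vertices, for `0 ≤ i < len`. -/
  sideEdge : Side → ℕ → E
  /-- `1` if this edge is directed along the positively oriented boundary, `-1` otherwise. -/
  sideSign : Side → ℕ → ℤˣ
  len_pos : ∀ A, 0 < len A
  sideEdge_ends : ∀ A, ∀ i < len A,
    (sideSign A i = 1 ∧ src (sideEdge A i) = sideVertex A i ∧
      tgt (sideEdge A i) = sideVertex A (i + 1)) ∨
    (sideSign A i = -1 ∧ src (sideEdge A i) = sideVertex A (i + 1) ∧
      tgt (sideEdge A i) = sideVertex A i)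
  /-- Consecutive sides meet in a corner. -/
  corner : ∀ A, sideVertex A (len A) = sideVertex A.next 0
  /-- The boundary walk is a simple closed curve. -/
  boundary_simple : ∀ A B, ∀ i < len A, ∀ j < len B,
    sideVertex A i = sideVertex B j → A = B ∧ i = j
  /-- Every edge lies on one or two cells. -/
  exists_cell : ∀ e, ∃ f, e ∈ (cell f).edges
  cells_le_two : ∀ e, {f | e ∈ (cell f).edges}.ncard ≤ 2
  /-- The cells are coherently oriented: the boundary of their sum is the boundary curve. -/
  oriented : ∑ f, (cell f).boundary =
    ∑ A, ∑ i ∈ Finset.range (len A), ((sideSign A i : ℤ) • Pi.single (sideEdge A i) 1 : E → ℤ)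
  /-- The 1-skeleton is connected. -/
  connected : ∀ x y, Relation.ReflTransGen
    (fun x y => ∃ e, (src e = x ∧ tgt e = y) ∨ (src e = y ∧ tgt e = x)) x y
  /-- Any two cells are joined by a chain of cells in which consecutive ones share an edge. -/
  strongly_connected : ∀ f f', Relation.ReflTransGen
    (fun f f' => ∃ e, e ∈ (cell f).edges ∧ e ∈ (cell f').edges) f f'
  /-- The Euler characteristic is that of a disk. -/
  euler : (Fintype.card V : ℤ) - Fintype.card E + Fintype.card F = 1

namespace TriangleLattice

variable {V E F : Type*} [Fintype V] [Fintype E] [Fintype F] [DecidableEq V] [DecidableEq E]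

/-- The vertex `v` lies on the side `A` (corners lie on two sides). -/
def OnSide (D : TriangleLattice V E F) (A : Side) (v : V) : Prop :=
  ∃ i ≤ D.len A, D.sideVertex A i = v

/-! ### Cochains -/

/-- The cup product of a 0-cochain with a 1-cochain. -/
def cup01 {R : Type*} [CommRing R] (D : TriangleLattice V E F) (u : V → R) (α : E → R) : E → R :=
  fun e => u (D.src e) * α e

/-- The cup product of a 1-cochain with a 0-cochain. -/
def cup10 {R : Type*} [CommRing R] (D : TriangleLattice V E F) (α : E → R) (u : V → R) : E → R :=
  fun e => α e * u (D.tgt e)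

/-- The integral over the whole surface of the cup product of two 1-cochains. -/
def intCup {R : Type*} [CommRing R] (D : TriangleLattice V E F) (α β : E → R) : R :=
  ∑ f, (D.cell f).cup α β

/-! ### The stabilizers -/

/-- The product of the Pauli `X` operators of colour `c` over the edges at `v`. -/
def xStar (D : TriangleLattice V E F) (c : Color) (v : V) : Hilb E →ₗ[ℂ] Hilb E :=
  xOp (fun e c' => if (D.src e = v ∨ D.tgt e = v) ∧ c' = c then 1 else 0)

/-- The pairs of edges `(e, e')` with `∫ v ∪ e ∪ e' ≠ 0`. -/
def pairsR (D : TriangleLattice V E F) (v : V) : Finset (E × E) :=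
  {p | D.intCup (D.cup01 (Pi.single v (1 : ZMod 2)) (Pi.single p.1 1)) (Pi.single p.2 1) ≠ 0}

/-- The pairs of edges `(e, e')` with `∫ e' ∪ v ∪ e ≠ 0`. -/
def pairsG (D : TriangleLattice V E F) (v : V) : Finset (E × E) :=
  {p | D.intCup (D.cup10 (Pi.single p.2 1) (Pi.single v (1 : ZMod 2))) (Pi.single p.1 1) ≠ 0}

/-- The pairs of edges `(e, e')` with `∫ e ∪ e' ∪ v ≠ 0`. -/
def pairsB (D : TriangleLattice V E F) (v : V) : Finset (E × E) :=
  {p | D.intCup (Pi.single p.1 1) (D.cup10 (Pi.single p.2 1) (Pi.single v (1 : ZMod 2))) ≠ 0}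

/-- The red vertex operator. -/
def starR (D : TriangleLattice V E F) (v : V) : Hilb E →ₗ[ℂ] Hilb E :=
  D.xStar .r v ∘ₗ diagOp (∏ p ∈ D.pairsR v, czGate .g .b p.1 p.2)

/-- The green vertex operator. -/
def starG (D : TriangleLattice V E F) (v : V) : Hilb E →ₗ[ℂ] Hilb E :=
  D.xStar .g v ∘ₗ diagOp (∏ p ∈ D.pairsG v, czGate .b .r p.1 p.2)

/-- The blue vertex operator. -/
def starB (D : TriangleLattice V E F) (v : V) : Hilb E →ₗ[ℂ] Hilb E :=
  D.xStar .b v ∘ₗ diagOp (∏ p ∈ D.pairsB v, czGate .r .g p.1 p.2)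

/-- The face operator of colour `c`: the product of Pauli `Z` over the edges of the cell `f`. -/
def plaquette (D : TriangleLattice V E F) (c : Color) (f : F) : Hilb E →ₗ[ℂ] Hilb E :=
  diagOp (((D.cell f).edges.map (zGate c)).prod)

/-- The stabilizers of the code with boundary.  On the sides the gauge fields satisfy
`L_r : a_r = 0`, `L_b : a_b = 0`, `L_rb : a_r + a_b = a_g = 0`; the vertex operators are those
compatible with these boundary conditions. -/
inductive IsStabilizer (D : TriangleLattice V E F) : (Hilb E →ₗ[ℂ] Hilb E) → Prop
  | face (c : Color) (f : F) : IsStabilizer D (D.plaquette c f)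
  | side_r (i : ℕ) (hi : i < D.len .r) :
      IsStabilizer D (diagOp (zGate .r (D.sideEdge .r i)))
  | side_b (i : ℕ) (hi : i < D.len .b) :
      IsStabilizer D (diagOp (zGate .b (D.sideEdge .b i)))
  | side_rb (i : ℕ) (hi : i < D.len .rb) :
      IsStabilizer D (diagOp (zGate .r (D.sideEdge .rb i) * zGate .b (D.sideEdge .rb i)))
  | side_rb_green (i : ℕ) (hi : i < D.len .rb) :
      IsStabilizer D (diagOp (zGate .g (D.sideEdge .rb i)))
  | star_r (v : V) (h : ¬ D.OnSide .r v) (h' : ¬ D.OnSide .rb v) :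
      IsStabilizer D (D.starR v)
  | star_g (v : V) (h : ¬ D.OnSide .rb v) :
      IsStabilizer D (D.starG v)
  | star_b (v : V) (h : ¬ D.OnSide .b v) (h' : ¬ D.OnSide .rb v) :
      IsStabilizer D (D.starB v)
  | star_rb (v : V) (h : D.OnSide .rb v) (hr : ¬ D.OnSide .r v) (hb : ¬ D.OnSide .b v) :
      IsStabilizer D (D.starR v ∘ₗ D.starB v)

/-- The code space: the common `+1` eigenspace of all stabilizers. -/
def codeSpace (D : TriangleLattice V E F) : Submodule ℂ (Hilb E) where
  carrier := {ψ | ∀ S, D.IsStabilizer S → S ψ = ψ}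
  add_mem' := by
    intro ψ φ hψ hφ S hS
    rw [map_add, hψ S hS, hφ S hS]
  zero_mem' := by
    intro S _
    exact map_zero S
  smul_mem' := by
    intro z ψ hψ S hS
    rw [map_smul, hψ S hS]

/-- The logical Pauli `Z`: the holonomy of the red gauge field along the side `L_rb`. -/
def logicalZ (D : TriangleLattice V E F) : Hilb E →ₗ[ℂ] Hilb E :=
  diagOp (∏ i ∈ Finset.range (D.len .rb), zGate .r (D.sideEdge .rb i))

/-! ### The automorphism operator `U = W V` -/

/-- The transversal operator `V`: on each edge, `CNOT` from red to green and from blue to green. -/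
def opV (_D : TriangleLattice V E F) : Hilb E →ₗ[ℂ] Hilb E :=
  permOp (Equiv.piCongrRight fun _ : E =>
    cnot .r .g (by decide) * cnot .b .g (by decide))

/-- The operator `W`: `CS` and `CS†` gates in the bulk, and `T†` on every edge of `L_rb` (`T` if
the edge is directed against the boundary orientation). -/
def opW (D : TriangleLattice V E F) : Hilb E →ₗ[ℂ] Hilb E :=
  diagOp ((∏ f, (D.cell f).csGates) *
    ∏ i ∈ Finset.range (D.len .rb), (tGate .r (D.sideEdge .rb i) ^ (D.sideSign .rb i : ℤ))⁻¹)

/-- The automorphism operator `U = W V`. -/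
def opU (D : TriangleLattice V E F) : Hilb E →ₗ[ℂ] Hilb E :=
  D.opW ∘ₗ D.opV

end TriangleLattice

end

end CliffordCode

/-!
Expand a state in the computational basis, whose labels are triples `a = (a_r, a_g, a_b)` of
`ZMod 2`-valued 1-cochains.  The face operators and the boundary `Z` operators restrict a code state
to flat configurations with the three boundary conditions (`IsAdmissible`).  On a disk flat fields
are coboundaries (`exists_potential`): the coboundary of 1-cochains is onto, because a 2-chain
without boundary is constant on a strongly connected complex and vanishes at a boundary edge, and
the Euler characteristic leaves no room for cohomology.  Let `u` be the potential of `a_r` that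
vanishes on `L_r`.  The vertex operators act on admissible configurations as gauge transformations,
with a phase that is exactly the change of `(-1) ^ ∫ u ∪ a_g ∪ a_b` (`action`); for the green and
blue ones this is integration by parts, and the boundary conditions kill the boundary terms
(`implements_starR`, `implements_starG`, `implements_starB`, `implements_starRB`).  Two admissible
configurations are gauge equivalent if and only if they have the same red holonomy `m` along `L_rb`
(`IsAdmissible.exists_gauge`).  So the code space is spanned by the two states
`∑ (-1) ^ action a |a⟩`, summed over the admissible `a` with holonomy `m` (`state`, `exists_coeff`).

The operator `V` replaces `a_g` by `a_g + a_r + a_b`, which changes the action by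
`∫ u ∪ (a_r + a_b) ∪ a_b`.  With `U`, `A`, `B` the lifts of `u`, `a_r`, `a_b` to integral cochains
with values `0` and `1`, the `CS` gates contribute `i ^ ∫ A ∪ B`, and on every cell
`A ∪ B + 2 U ∪ (A + B) ∪ B = d (U ∪ B)` modulo `4` (`four_dvd_cup`).  By Stokes only the integral
of `U ∪ B` over the boundary is left.  It vanishes on `L_r`, where `U = 0`, and on `L_b`, where
`B = 0`; on `L_rb` one has `A = B`, and `2 U ∪ A - A = - d U` shows that together with the `T†`
gates it gives `exp (π i / 4)` to the power `- ∫ d U = - m` (`IsAdmissible.eight_dvd`).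
-/

namespace CliffordCode

set_option linter.unusedSectionVars false

noncomputable section

/-! ### Signs and monomial operators -/

/-- The nontrivial character `x ↦ (-1) ^ x` of `ZMod 2`. -/
def sgn (x : ZMod 2) : ℂ := if x = 1 then -1 else 1

@[simp] lemma sgn_zero : sgn 0 = 1 := by simp [sgn]

lemma sgn_one : sgn 1 = -1 := by simp [sgn]

lemma sgn_add (x y : ZMod 2) : sgn (x + y) = sgn x * sgn y := by
  have h : ∀ z : ZMod 2, z = 0 ∨ z = 1 := by decide
  have h2 : (1 : ZMod 2) + 1 = 0 := by decide
  rcases h x with rfl | rfl <;> rcases h y with rfl | rfl <;> simp [sgn, h2]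

lemma sgn_sum {ι : Type*} (s : Finset ι) (f : ι → ZMod 2) :
    sgn (∑ i ∈ s, f i) = ∏ i ∈ s, sgn (f i) := by
  classical
  induction s using Finset.induction_on with
  | empty => simp
  | insert i s hi ih => rw [Finset.sum_insert hi, Finset.prod_insert hi, sgn_add, ih]

lemma sgn_mul_self (x : ZMod 2) : sgn x * sgn x = 1 := by
  rw [← sgn_add, CharTwo.add_self_eq_zero, sgn_zero]

lemma sgn_eq_one_iff {x : ZMod 2} : sgn x = 1 ↔ x = 0 := by
  have h : ∀ z : ZMod 2, z = 0 ∨ z = 1 := by decide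
  rcases h x with rfl | rfl
  · simp
  · norm_num [sgn]

lemma norm_sgn (x : ZMod 2) : ‖sgn x‖ = 1 := by
  unfold sgn
  split_ifs <;> simp

section Operators

variable {E : Type*} [Fintype E] [DecidableEq E]

lemma diagOp_apply (f : Config E → ℂ) (ψ : Hilb E) (a : Config E) :
    diagOp f ψ a = f a * ψ a := rfl

lemma permOp_apply (σ : Equiv.Perm (Config E)) (ψ : Hilb E) (a : Config E) :
    permOp σ ψ a = ψ (σ.symm a) := rfl

lemma xOp_apply_add (s : Config E) (ψ : Hilb E) (a : Config E) :
    xOp s ψ (a + s) = ψ a := by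
  simp [xOp, permOp_apply]

lemma diagOp_mem_unitary (f : Config E → ℂ) (hf : ∀ a, ‖f a‖ = 1) :
    diagOp f ∈ unitary (Hilb E →ₗ[ℂ] Hilb E) := by
  have hadj : star (diagOp f) = diagOp (fun a => star (f a)) := by
    rw [LinearMap.star_eq_adjoint, eq_comm, LinearMap.eq_adjoint_iff]
    intro x y
    simp only [PiLp.inner_apply, diagOp_apply]
    refine Finset.sum_congr rfl fun a _ => ?_
    simp only [RCLike.inner_apply, map_mul, RCLike.star_def, RCLike.conj_conj]
    ring
  have hmul : ∀ a, f a * star (f a) = 1 := fun a => by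
    have := Complex.mul_conj' (f a)
    rw [RCLike.star_def, this, hf]
    simp
  rw [Unitary.mem_iff, hadj]
  constructor
  all_goals
    ext ψ a
    simp only [Module.End.mul_apply, diagOp_apply, Module.End.one_apply, ← mul_assoc]
  · rw [mul_comm (star _), hmul, one_mul]
  · rw [hmul, one_mul]

lemma permOp_mem_unitary (σ : Equiv.Perm (Config E)) :
    permOp σ ∈ unitary (Hilb E →ₗ[ℂ] Hilb E) := by
  have hadj : star (permOp σ) = permOp σ.symm := by
    rw [LinearMap.star_eq_adjoint, eq_comm, LinearMap.eq_adjoint_iff]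
    intro x y
    simp only [PiLp.inner_apply, permOp_apply, Equiv.symm_symm]
    rw [← Equiv.sum_comp σ.symm]
    simp
  rw [Unitary.mem_iff, hadj]
  constructor
  all_goals
    ext ψ a
    simp [Module.End.mul_apply, permOp_apply, Module.End.one_apply]

end Operators

/-- The 1-cochain formed by the labels of colour `c`. -/
def field {E : Type*} (c : Color) (a : Config E) : E → ZMod 2 := fun e => a e c

@[simp] lemma field_add {E : Type*} (c : Color) (a b : Config E) :
    field c (a + b) = field c a + field c b := rfl

/-! ### Stokes and Leibniz -/

namespace Cell

variable {V E : Type*}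

/-- The integral of the coboundary of a 1-cochain over a cell. -/
def curl {R : Type*} [CommRing R] (β : E → R) : Cell E → R
  | triangle σ e01 e12 e02 => ((σ : ℤ) : R) * (β e01 + β e12 - β e02)
  | square σ e01 e13 e02 e23 => ((σ : ℤ) : R) * (β e01 + β e13 - β e02 - β e23)

lemma sum_boundary_mul [Fintype E] [DecidableEq E] {R : Type*} [CommRing R] (β : E → R)
    (K : Cell E) : ∑ e, ((K.boundary e : ℤ) : R) * β e = K.curl β := by
  cases K <;>
  simp [boundary, curl, Pi.single_apply, mul_assoc, ← Finset.mul_sum, add_mul, sub_mul,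
    Finset.sum_add_distrib, Finset.sum_sub_distrib]

lemma curl_add {R : Type*} [CommRing R] (α β : E → R) (K : Cell E) :
    K.curl (α + β) = K.curl α + K.curl β := by
  cases K <;> simp [curl] <;> ring

lemma curl_smul {R : Type*} [CommRing R] (c : R) (α : E → R) (K : Cell E) :
    K.curl (c • α) = c * K.curl α := by
  cases K <;> simp [curl] <;> ring

lemma cast_units (σ : ℤˣ) : ((σ : ℤ) : ZMod 2) = 1 := by
  rcases Int.units_eq_one_or σ with rfl | rfl
  · simp
  · decide

/-- Over `ZMod 2` signs play no role, and a face operator measures the curl. -/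
lemma curl_eq_sum_edges (β : E → ZMod 2) (K : Cell E) : K.curl β = (K.edges.map β).sum := by
  cases K <;> simp [curl, edges, cast_units, CharTwo.sub_eq_add, add_assoc]

end Cell

namespace TriangleLattice

variable {V E F : Type*} [Fintype V] [Fintype E] [Fintype F] [DecidableEq V] [DecidableEq E]
  (D : TriangleLattice V E F)

/-- The coboundary of a 0-cochain. -/
def d {M : Type*} [AddCommGroup M] (u : V → M) : E → M := fun e => u (D.tgt e) - u (D.src e)

/-- The integral of a 1-cochain over one side of the boundary. -/
def sideInt {R : Type*} [CommRing R] (A : Side) (β : E → R) : R :=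
  ∑ i ∈ Finset.range (D.len A), ((D.sideSign A i : ℤ) : R) * β (D.sideEdge A i)

lemma d_add {M : Type*} [AddCommGroup M] (u w : V → M) : D.d (u + w) = D.d u + D.d w := by
  funext e
  simp only [d, Pi.add_apply]
  abel

lemma field_d (c : Color) (l : V → Color → ZMod 2) :
    field c (D.d l) = D.d (fun v => l v c) := rfl

lemma sum_curl {R : Type*} [CommRing R] (β : E → R) :
    ∑ f, (D.cell f).curl β = ∑ A, D.sideInt A β := by
  simp_rw [← Cell.sum_boundary_mul]
  rw [Finset.sum_comm]
  simp_rw [← Finset.sum_mul, ← Int.cast_sum, ← Finset.sum_apply, D.oriented]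
  simp only [Finset.sum_apply, Pi.smul_apply, smul_eq_mul, Int.cast_sum, Int.cast_mul,
    Finset.sum_mul, sideInt]
  rw [Finset.sum_comm]
  refine Finset.sum_congr rfl fun A _ => ?_
  rw [Finset.sum_comm]
  refine Finset.sum_congr rfl fun i _ => ?_
  rw [Finset.sum_eq_single (D.sideEdge A i)]
  · simp
  · intro e _ he
    simp [he]
  · simp

lemma sideInt_eq_zero {R : Type*} [CommRing R] {A : Side} {β : E → R}
    (h : ∀ i < D.len A, β (D.sideEdge A i) = 0) : D.sideInt A β = 0 :=
  Finset.sum_eq_zero fun i hi => by rw [h i (Finset.mem_range.1 hi), mul_zero]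

lemma sideInt_d {R : Type*} [CommRing R] (A : Side) (u : V → R) :
    D.sideInt A (D.d u) = u (D.sideVertex A (D.len A)) - u (D.sideVertex A 0) := by
  rw [← Finset.sum_range_sub (fun i => u (D.sideVertex A i))]
  refine Finset.sum_congr rfl fun i hi => ?_
  rcases D.sideEdge_ends A i (Finset.mem_range.1 hi) with ⟨h1, h2, h3⟩ | ⟨h1, h2, h3⟩ <;>
    simp [h1, h2, h3, d]

lemma curl_d {R : Type*} [CommRing R] (u : V → R) (f : F) : (D.cell f).curl (D.d u) = 0 := by
  have h := D.wellFormed f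
  generalize D.cell f = K at h ⊢
  rcases K with ⟨σ, e01, e12, e02⟩ | ⟨σ, e01, e13, e02, e23⟩
  · obtain ⟨h1, h2, h3⟩ := h
    simp only [Cell.curl, d, h1, h2, h3]
    ring
  · obtain ⟨h1, h2, h3, h4, -, -⟩ := h
    simp only [Cell.curl, d, h1, h2, h3, h4]
    ring

/-- The Leibniz rule for `u ∪ β` with a cocycle `β`. -/
lemma curl_cup01 {R : Type*} [CommRing R] (u : V → R) {β : E → R} {f : F}
    (hβ : (D.cell f).curl β = 0) :
    (D.cell f).curl (D.cup01 u β) = (D.cell f).cup (D.d u) β := by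
  have h := D.wellFormed f
  generalize D.cell f = K at h hβ ⊢
  rcases K with ⟨σ, e01, e12, e02⟩ | ⟨σ, e01, e13, e02, e23⟩
  · obtain ⟨h1, h2, h3⟩ := h
    simp only [Cell.curl, Cell.cup, cup01, d, ← h1, ← h2] at hβ ⊢
    linear_combination u (D.src e01) * hβ
  · obtain ⟨h1, h2, h3, h4, -, -⟩ := h
    simp only [Cell.curl, Cell.cup, cup01, d, ← h1, ← h2, ← h3] at hβ ⊢
    linear_combination u (D.src e01) * hβ

/-- The Leibniz rule for `u ∪ γ ∪ w` with 0-cochains `u`, `w` and a cocycle `γ`. -/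
lemma curl_cup01_cup10 {R : Type*} [CommRing R] (u w : V → R) {γ : E → R} {f : F}
    (hγ : (D.cell f).curl γ = 0) :
    (D.cell f).curl (D.cup10 (D.cup01 u γ) w) =
      (D.cell f).cup (D.d u) (D.cup10 γ w) - (D.cell f).cup (D.cup01 u γ) (D.d w) := by
  have h := D.wellFormed f
  generalize D.cell f = K at h hγ ⊢
  rcases K with ⟨σ, e01, e12, e02⟩ | ⟨σ, e01, e13, e02, e23⟩
  · obtain ⟨h1, h2, h3⟩ := h
    simp only [Cell.curl, Cell.cup, cup01, cup10, d, ← h1, ← h2, ← h3] at hγ ⊢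
    linear_combination u (D.src e01) * w (D.tgt e12) * hγ
  · obtain ⟨h1, h2, h3, h4, -, -⟩ := h
    simp only [Cell.curl, Cell.cup, cup01, cup10, d, ← h1, ← h2, ← h3, ← h4] at hγ ⊢
    linear_combination u (D.src e01) * w (D.tgt e13) * hγ

lemma intCup_add_left {R : Type*} [CommRing R] (α α' β : E → R) :
    D.intCup (α + α') β = D.intCup α β + D.intCup α' β := by
  rw [intCup, intCup, intCup, ← Finset.sum_add_distrib]
  refine Finset.sum_congr rfl fun f _ => ?_
  cases D.cell f <;> simp [Cell.cup] <;> ring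

lemma intCup_add_right {R : Type*} [CommRing R] (α β β' : E → R) :
    D.intCup α (β + β') = D.intCup α β + D.intCup α β' := by
  rw [intCup, intCup, intCup, ← Finset.sum_add_distrib]
  refine Finset.sum_congr rfl fun f _ => ?_
  cases D.cell f <;> simp [Cell.cup] <;> ring

/-- The cup product pairing as a bilinear map. -/
def intCupBilin {R : Type*} [CommRing R] : (E → R) →ₗ[R] (E → R) →ₗ[R] R :=
  LinearMap.mk₂ R D.intCup D.intCup_add_left
    (fun c α β => by
      rw [intCup, intCup, smul_eq_mul, Finset.mul_sum]
      refine Finset.sum_congr rfl fun f _ => ?_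
      cases D.cell f <;> simp [Cell.cup] <;> ring)
    D.intCup_add_right
    (fun c α β => by
      rw [intCup, intCup, smul_eq_mul, Finset.mul_sum]
      refine Finset.sum_congr rfl fun f _ => ?_
      cases D.cell f <;> simp [Cell.cup] <;> ring)

/-- A product of controlled-`Z` gates over the support of a bilinear form is the sign of the
value of the form. -/
lemma prod_czGate (B : (E → ZMod 2) →ₗ[ZMod 2] (E → ZMod 2) →ₗ[ZMod 2] ZMod 2) (c c' : Color)
    (a : Config E) :
    (∏ p ∈ ({p | B (Pi.single p.1 1) (Pi.single p.2 1) ≠ 0} : Finset (E × E)),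
      czGate c c' p.1 p.2) a = sgn (B (field c a) (field c' a)) := by
  have hcz : ∀ p : E × E, czGate c c' p.1 p.2 a = sgn (a p.1 c * a p.2 c') := fun p => by
    have h : ∀ x y : ZMod 2, (x = 1 ∧ y = 1) ↔ x * y = 1 := by decide
    simp only [czGate, sgn, h]
  rw [Finset.prod_apply]
  simp_rw [hcz]
  rw [← sgn_sum]
  congr 1
  have hexp : ∀ α : E → ZMod 2, α = ∑ e, α e • Pi.single e (1 : ZMod 2) := fun α => by
    simpa using (pi_eq_sum_univ' α)
  rw [hexp (field c a), hexp (field c' a)]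
  simp only [map_sum, LinearMap.sum_apply, map_smul, LinearMap.smul_apply, smul_eq_mul,
    Finset.mul_sum]
  rw [Finset.sum_filter, Fintype.sum_prod_type, Finset.sum_comm]
  refine Finset.sum_congr rfl fun e _ => Finset.sum_congr rfl fun e' _ => ?_
  have h : ∀ x y z : ZMod 2, (if z ≠ 0 then x * y else 0) = y * (x * z) := by decide
  exact h _ _ _

end TriangleLattice

/-! ### Exactness of cochains on the disk -/

namespace TriangleLattice

variable {V E F : Type*} [Fintype V] [Fintype E] [Fintype F] [DecidableEq V] [DecidableEq E]
  (D : TriangleLattice V E F)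

/-- The edges of a cell are distinct: two equal ones would identify vertices of the cell or be a
loop. -/
lemma edges_nodup (f : F) : (D.cell f).edges.Nodup := by
  have h := D.wellFormed f
  generalize D.cell f = K at h ⊢
  rcases K with ⟨σ, e01, e12, e02⟩ | ⟨σ, e01, e13, e02, e23⟩
  · obtain ⟨h1, h2, h3⟩ := h
    have h4 := D.no_loop e01
    have h5 := D.no_loop e12
    simp only [Cell.edges, List.nodup_cons, List.mem_cons, List.not_mem_nil, or_false,
      not_false_eq_true, List.nodup_nil, and_true, not_or]
    refine ⟨⟨?_, ?_⟩, ?_⟩ <;> rintro rfl <;> simp_all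
  · obtain ⟨h1, h2, h3, h4, h5, h6⟩ := h
    have h7 := D.no_loop e01
    have h8 := D.no_loop e02
    have h9 := D.no_loop e13
    have h10 := D.no_loop e23
    simp only [Cell.edges, List.nodup_cons, List.mem_cons, List.not_mem_nil, or_false,
      not_false_eq_true, List.nodup_nil, and_true, not_or]
    refine ⟨⟨?_, ?_, ?_⟩, ⟨?_, ?_⟩, ?_⟩ <;> rintro rfl <;> simp_all

/-- The coboundary of 1-cochains with coefficients in `ZMod 2`. -/
def d₁ : (E → ZMod 2) →ₗ[ZMod 2] (F → ZMod 2) where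
  toFun α f := (D.cell f).curl α
  map_add' α β := funext fun f => Cell.curl_add α β (D.cell f)
  map_smul' c α := funext fun f => Cell.curl_smul c α (D.cell f)

/-- The coboundary of 0-cochains with coefficients in `ZMod 2`. -/
def d₀ : (V → ZMod 2) →ₗ[ZMod 2] (E → ZMod 2) where
  toFun := D.d
  map_add' := D.d_add
  map_smul' c u := by
    funext e
    simp [d, mul_sub]

lemma d₁_single (e : E) (f : F) :
    D.d₁ (Pi.single e 1) f = if e ∈ (D.cell f).edges then 1 else 0 := by
  change (D.cell f).curl _ = _
  have h := D.edges_nodup f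
  rw [Cell.curl_eq_sum_edges]
  generalize (D.cell f).edges = l at h
  induction l with
  | nil => simp
  | cons x l ih =>
    obtain ⟨hx, hl⟩ := List.nodup_cons.1 h
    rw [List.map_cons, List.sum_cons, ih hl]
    by_cases hex : e = x
    · subst hex
      simp [hx]
    · simp [hex, Ne.symm hex]

/-- The first edge of the side `L_rb` occurs only once on the boundary walk: its initial vertex
is met only once, and the other boundary edge at that vertex leads to the side `L_r`. -/
lemma first_edge_unique {A : Side} {i : ℕ} (hi : i < D.len A)
    (h : D.sideEdge A i = D.sideEdge .rb 0) : A = .rb ∧ i = 0 := by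
  have h0 := D.len_pos .rb
  have hS : ∀ j < D.len .r, D.sideVertex .rb 1 ≠ D.sideVertex .r j := by
    intro j hj he
    rcases (Nat.succ_le_of_lt h0).lt_or_eq with h1 | h1
    · exact absurd (D.boundary_simple _ _ _ h1 _ hj he).1 (by decide)
    · have hc := D.corner .rb
      rw [← h1] at hc
      exact absurd (D.boundary_simple _ _ _ (D.len_pos .b) _ hj (hc.symm.trans he)).1 (by decide)
  -- the two orientations of the edge reduce to an equality of unordered pairs of vertices
  have key : (D.sideVertex A i = D.sideVertex .rb 0) ∨
      (D.sideVertex A (i + 1) = D.sideVertex .rb 0 ∧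
        D.sideVertex A i = D.sideVertex .rb 1) := by
    have h1 := D.sideEdge_ends A i hi
    have h2 := D.sideEdge_ends .rb 0 h0
    rw [h] at h1
    rcases h1 with ⟨-, h1, h1'⟩ | ⟨-, h1, h1'⟩ <;> rcases h2 with ⟨-, h2, h2'⟩ | ⟨-, h2, h2'⟩ <;>
      simp_all
  rcases key with hk | ⟨hk, hk'⟩
  · exact D.boundary_simple _ _ _ hi _ h0 hk
  · exfalso
    rcases (Nat.succ_le_of_lt hi).lt_or_eq with h1 | h1
    · exact absurd (D.boundary_simple _ _ _ h1 _ h0 hk).2 (by simp)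
    · rw [Nat.succ_eq_add_one] at h1
      rw [h1, D.corner A] at hk
      have hA := (D.boundary_simple _ _ _ (D.len_pos _) _ h0 hk).1
      have hAr : A = .r := by cases A <;> simp_all [Side.next]
      subst hAr
      exact hS i hi hk'.symm

/-- The number of cells at the first edge of `L_rb` is odd. -/
lemma sum_d₁_first_edge : ∑ f, D.d₁ (Pi.single (D.sideEdge .rb 0) 1) f = 1 := by
  have hs := D.sum_curl (Pi.single (D.sideEdge .rb 0) (1 : ZMod 2))
  refine hs.trans ?_
  have hrb : D.sideInt .rb (Pi.single (D.sideEdge .rb 0) (1 : ZMod 2)) = 1 := by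
    rw [sideInt, Finset.sum_eq_single 0]
    · simp [Cell.cast_units]
    · intro i hi hi0
      have : D.sideEdge .rb i ≠ D.sideEdge .rb 0 := fun h =>
        hi0 (D.first_edge_unique (Finset.mem_range.1 hi) h).2
      simp [this]
    · intro h
      exact absurd (Finset.mem_range.2 (D.len_pos .rb)) h
  rw [Finset.sum_eq_single Side.rb, hrb]
  · intro A _ hA
    refine D.sideInt_eq_zero fun i hi => ?_
    have : D.sideEdge A i ≠ D.sideEdge .rb 0 := fun h => hA (D.first_edge_unique hi h).1
    simp [this]
  · simp

/-- A 2-chain without boundary vanishes: it takes the same value on cells sharing an edge, hence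
is constant, and a boundary edge lies on an odd number of cells. -/
lemma chain_eq_zero (c : F → ZMod 2) (hc : ∀ e, ∑ f, c f * D.d₁ (Pi.single e 1) f = 0) :
    c = 0 := by
  classical
  have hstep : ∀ f f', (∃ e, e ∈ (D.cell f).edges ∧ e ∈ (D.cell f').edges) → c f = c f' := by
    rintro f f' ⟨e, h, h'⟩
    by_cases hff : f = f'
    · rw [hff]
    have hset : ({f, f'} : Set F) = {f | e ∈ (D.cell f).edges} := by
      refine Set.eq_of_subset_of_ncard_le ?_ ?_
      · rintro x (rfl | rfl) <;> assumption
      · rw [Set.ncard_pair hff]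
        exact D.cells_le_two e
    have hsum := hc e
    rw [← Finset.sum_subset (Finset.subset_univ {f, f'}), Finset.sum_pair hff, d₁_single,
      d₁_single, if_pos h, if_pos h', mul_one, mul_one] at hsum
    · exact CharTwo.add_eq_zero.1 hsum
    · intro x _ hx
      have : x ∉ ({f, f'} : Set F) := by simpa using hx
      rw [hset] at this
      rw [d₁_single, if_neg (show ¬ e ∈ (D.cell x).edges from this), mul_zero]
  have hconst : ∀ f f', c f = c f' := by
    intro f f'
    induction D.strongly_connected f f' with
    | refl => rfl
    | tail _ h ih => exact ih.trans (hstep _ _ h)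
  funext f
  have h := hc (D.sideEdge .rb 0)
  simp_rw [fun f' => hconst f' f, ← Finset.mul_sum, D.sum_d₁_first_edge, mul_one] at h
  exact h

lemma d₁_surjective : Function.Surjective D.d₁ := by
  classical
  rw [← LinearMap.range_eq_top]
  by_contra hne
  obtain ⟨φ, hφ, hle⟩ := Submodule.exists_le_ker_of_lt_top _ (lt_top_iff_ne_top.2 hne)
  have hexp : ∀ g : F → ZMod 2, φ g = ∑ f, φ (Pi.single f 1) * g f := fun g => by
    conv_lhs => rw [pi_eq_sum_univ' g]
    simp [mul_comm]
  have hz := D.chain_eq_zero (fun f => φ (Pi.single f 1)) fun e => by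
    rw [← hexp]
    exact hle (LinearMap.mem_range_self _ _)
  refine hφ (LinearMap.ext fun g => ?_)
  rw [hexp]
  exact Finset.sum_eq_zero fun f _ => by rw [congrFun hz f, Pi.zero_apply, zero_mul]

/-- A 0-cochain with vanishing coboundary is constant. -/
lemma eq_of_d_eq_zero {M : Type*} [AddCommGroup M] {u : V → M} (hu : D.d u = 0) (x y : V) :
    u x = u y := by
  induction D.connected x y with
  | refl => rfl
  | tail _ h ih =>
    obtain ⟨e, ⟨rfl, rfl⟩ | ⟨rfl, rfl⟩⟩ := h
    · exact ih.trans (sub_eq_zero.1 (congrFun hu e)).symm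
    · exact ih.trans (sub_eq_zero.1 (congrFun hu e))

/-- The first cohomology of the disk vanishes, by counting dimensions: the coboundary of
1-cochains is onto, that of 0-cochains has only constants in its kernel, and the Euler
characteristic is `1`. -/
theorem exists_potential {α : E → ZMod 2} (hα : ∀ f, (D.cell f).curl α = 0) (v : V) :
    ∃ u : V → ZMod 2, D.d u = α ∧ u v = 0 := by
  have hle : LinearMap.range D.d₀ ≤ LinearMap.ker D.d₁ := by
    rintro _ ⟨u, rfl⟩
    exact LinearMap.mem_ker.2 (funext fun f => D.curl_d u f)
  have hker : Module.finrank (ZMod 2) (LinearMap.ker D.d₀) ≤ 1 := by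
    refine finrank_le_one ⟨1, LinearMap.mem_ker.2 (funext fun e => sub_self _)⟩ fun u => ?_
    refine ⟨u.1 v, Subtype.ext (funext fun w => ?_)⟩
    have := D.eq_of_d_eq_zero (LinearMap.mem_ker.1 u.2) v w
    simpa using this
  have h0 := LinearMap.finrank_range_add_finrank_ker D.d₀
  have h1 := LinearMap.finrank_range_add_finrank_ker D.d₁
  rw [LinearMap.range_eq_top.2 D.d₁_surjective, finrank_top] at h1
  simp only [Module.finrank_fintype_fun_eq_card] at h0 h1
  have he := D.euler
  have heq : LinearMap.range D.d₀ = LinearMap.ker D.d₁ :=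
    Submodule.eq_of_le_of_finrank_le hle (by omega)
  have hmem : α ∈ LinearMap.range D.d₀ := by
    rw [heq]
    exact LinearMap.mem_ker.2 (funext hα)
  obtain ⟨u, rfl⟩ := hmem
  refine ⟨fun w => u w - u v, ?_, sub_self _⟩
  funext e
  simp [d, d₀]

end TriangleLattice

/-! ### Admissible configurations and gauge transformations -/

namespace TriangleLattice

variable {V E F : Type*} [Fintype V] [Fintype E] [Fintype F] [DecidableEq V] [DecidableEq E]
  (D : TriangleLattice V E F)

/-- The configurations allowed by the face operators and the boundary `Z` operators: flat gauge
fields with the boundary conditions of the three sides. -/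
structure IsAdmissible (a : Config E) : Prop where
  flat : ∀ c f, (D.cell f).curl (field c a) = 0
  red : ∀ i < D.len .r, a (D.sideEdge .r i) .r = 0
  blue : ∀ i < D.len .b, a (D.sideEdge .b i) .b = 0
  mixed : ∀ i < D.len .rb, a (D.sideEdge .rb i) .r + a (D.sideEdge .rb i) .b = 0
  green : ∀ i < D.len .rb, a (D.sideEdge .rb i) .g = 0

/-- The gauge parameters compatible with the boundary conditions. -/
structure IsGauge (l : V → Color → ZMod 2) : Prop where
  red : ∀ v, D.OnSide .r v → l v .r = 0
  blue : ∀ v, D.OnSide .b v → l v .b = 0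
  mixed : ∀ v, D.OnSide .rb v → l v .r = l v .b
  green : ∀ v, D.OnSide .rb v → l v .g = 0

variable {D}

lemma onSide_ends {A : Side} {i : ℕ} (hi : i < D.len A) :
    D.OnSide A (D.src (D.sideEdge A i)) ∧ D.OnSide A (D.tgt (D.sideEdge A i)) := by
  rcases D.sideEdge_ends A i hi with ⟨-, h1, h2⟩ | ⟨-, h1, h2⟩
  · exact ⟨⟨i, hi.le, h1.symm⟩, ⟨i + 1, hi, h2.symm⟩⟩
  · exact ⟨⟨i + 1, hi, h1.symm⟩, ⟨i, hi.le, h2.symm⟩⟩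

lemma onSide_first (A : Side) : D.OnSide A (D.sideVertex A 0) := ⟨0, Nat.zero_le _, rfl⟩

lemma onSide_last (A : Side) : D.OnSide A (D.sideVertex A (D.len A)) := ⟨_, le_rfl, rfl⟩

/-- The corner between `L_r` and `L_rb`. -/
lemma onSide_r_corner : D.OnSide .r (D.sideVertex .rb 0) := ⟨_, le_rfl, D.corner .r⟩

/-- The corner between `L_rb` and `L_b`. -/
lemma onSide_b_corner : D.OnSide .b (D.sideVertex .rb (D.len .rb)) :=
  ⟨0, Nat.zero_le _, (D.corner .rb).symm⟩

lemma eq_on_side {M : Type*} [AddCommGroup M] {A : Side} {u : V → M}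
    (hu : ∀ i < D.len A, D.d u (D.sideEdge A i) = 0) {v w : V} (hv : D.OnSide A v)
    (hw : D.OnSide A w) : u v = u w := by
  have key : ∀ i ≤ D.len A, u (D.sideVertex A i) = u (D.sideVertex A 0) := by
    intro i
    induction i with
    | zero => exact fun _ => rfl
    | succ i ih =>
      intro hi
      rw [← ih (Nat.le_of_succ_le hi)]
      have h := sub_eq_zero.1 (hu i hi)
      rcases D.sideEdge_ends A i hi with ⟨-, h1, h2⟩ | ⟨-, h1, h2⟩
      · rw [← h1, ← h2, h]
      · rw [← h1, ← h2, h]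
  obtain ⟨i, hi, rfl⟩ := hv
  obtain ⟨j, hj, rfl⟩ := hw
  rw [key i hi, key j hj]

lemma IsAdmissible.add {a b : Config E} (ha : D.IsAdmissible a) (hb : D.IsAdmissible b) :
    D.IsAdmissible (a + b) where
  flat c f := by rw [field_add, Cell.curl_add, ha.flat, hb.flat, add_zero]
  red i hi := by simp [ha.red i hi, hb.red i hi]
  blue i hi := by simp [ha.blue i hi, hb.blue i hi]
  mixed i hi := by
    have h := congrArg₂ (· + ·) (ha.mixed i hi) (hb.mixed i hi)
    simp only [add_zero] at h
    rw [← h]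
    simp only [Pi.add_apply]
    ring
  green i hi := by simp [ha.green i hi, hb.green i hi]

lemma IsGauge.admissible {l : V → Color → ZMod 2} (hl : D.IsGauge l) :
    D.IsAdmissible (D.d l) where
  flat c f := by rw [field_d, curl_d]
  red i hi := by
    have h := onSide_ends hi
    simp [d, hl.red _ h.1, hl.red _ h.2]
  blue i hi := by
    have h := onSide_ends hi
    simp [d, hl.blue _ h.1, hl.blue _ h.2]
  mixed i hi := by
    have h := onSide_ends hi
    simp [d, hl.mixed _ h.1, hl.mixed _ h.2, CharTwo.add_self_eq_zero]
  green i hi := by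
    have h := onSide_ends hi
    simp [d, hl.green _ h.1, hl.green _ h.2]

lemma add_self_config (a : Config E) : a + a = 0 := by
  funext e c
  exact CharTwo.add_self_eq_zero _

lemma IsGauge.admissible_add_iff {l : V → Color → ZMod 2} (hl : D.IsGauge l) {a : Config E} :
    D.IsAdmissible (a + D.d l) ↔ D.IsAdmissible a := by
  refine ⟨fun h => ?_, fun h => h.add hl.admissible⟩
  have := h.add hl.admissible
  rwa [add_assoc, add_self_config, add_zero] at this

variable (D)

/-- The red holonomy along `L_rb`, the label of the logical basis states. -/
def hol (a : Config E) : ZMod 2 := D.sideInt .rb (field .r a)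

lemma hol_add (a b : Config E) : D.hol (a + b) = D.hol a + D.hol b := by
  simp [hol, sideInt, mul_add, Finset.sum_add_distrib]

variable {D}

lemma IsGauge.hol_eq_zero {l : V → Color → ZMod 2} (hl : D.IsGauge l) : D.hol (D.d l) = 0 := by
  rw [hol, field_d, sideInt_d, hl.mixed _ (onSide_last _), hl.blue _ onSide_b_corner,
    hl.red _ onSide_r_corner, sub_zero]

/-- An admissible configuration without holonomy is a pure gauge. -/
lemma IsAdmissible.exists_gauge {a : Config E} (ha : D.IsAdmissible a) (h : D.hol a = 0) :
    ∃ l, D.IsGauge l ∧ a = D.d l := by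
  obtain ⟨x, hx, hx0⟩ := D.exists_potential (ha.flat .r) (D.sideVertex .rb 0)
  obtain ⟨z, hz, hz0⟩ := D.exists_potential (ha.flat .g) (D.sideVertex .rb 0)
  obtain ⟨y, hy, hy0⟩ := D.exists_potential (ha.flat .b) (D.sideVertex .rb (D.len .rb))
  have hx1 : x (D.sideVertex .rb (D.len .rb)) = 0 := by
    rw [hol, ← hx, sideInt_d, hx0, sub_zero] at h
    exact h
  have hxy : ∀ v, D.OnSide .rb v → (x + y) v = 0 := fun v hv => by
    rw [eq_on_side (A := .rb) (u := x + y) (fun i hi => ?_) hv (onSide_last _), Pi.add_apply, hx1,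
      hy0, add_zero]
    rw [d_add, hx, hy]
    exact ha.mixed i hi
  refine ⟨fun v c => Color.rec (x v) (z v) (y v) c, ⟨fun v hv => ?_, fun v hv => ?_,
    fun v hv => ?_, fun v hv => ?_⟩, ?_⟩
  · exact (eq_on_side (u := x) (fun i hi => by rw [hx]; exact ha.red i hi) hv
      onSide_r_corner).trans hx0
  · exact (eq_on_side (u := y) (fun i hi => by rw [hy]; exact ha.blue i hi) hv
      onSide_b_corner).trans hy0
  · exact CharTwo.add_eq_zero.1 (hxy v hv)
  · exact (eq_on_side (u := z) (fun i hi => by rw [hz]; exact ha.green i hi) hv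
      (onSide_first _)).trans hz0
  · funext e c
    cases c
    · exact (congrFun hx e).symm
    · exact (congrFun hz e).symm
    · exact (congrFun hy e).symm

/-- Both values of the holonomy occur. -/
lemma exists_admissible (m : ZMod 2) : ∃ a, D.IsAdmissible a ∧ D.hol a = m := by
  have hm : m = 0 ∨ m = 1 := by revert m; decide
  rcases hm with rfl | rfl
  · have h0 : D.IsGauge (0 : V → Color → ZMod 2) :=
      ⟨fun _ _ => rfl, fun _ _ => rfl, fun _ _ => rfl, fun _ _ => rfl⟩
    exact ⟨_, h0.admissible, h0.hol_eq_zero⟩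
  classical
  -- the sides `L_rb` and `L_r` meet only in the first vertex of `L_rb`, which is not on `L_b`
  have hrr : ∀ v, D.OnSide .rb v → D.OnSide .r v → v = D.sideVertex .rb 0 := by
    rintro v ⟨i, hi, rfl⟩ ⟨j, hj, hij⟩
    rcases hj.lt_or_eq with hj | rfl
    · rcases hi.lt_or_eq with hi | rfl
      · exact absurd (D.boundary_simple _ _ _ hj _ hi hij).1 (by decide)
      · exact absurd (D.boundary_simple _ _ _ hj _ (D.len_pos _)
          (hij.trans (D.corner .rb))).1 (by decide)
    · exact hij.symm.trans (D.corner .r)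
  have hb : ¬ D.OnSide .b (D.sideVertex .rb 0) := by
    rintro ⟨i, hi, h⟩
    rcases hi.lt_or_eq with hi | rfl
    · exact absurd (D.boundary_simple _ _ _ hi _ (D.len_pos _) h).1 (by decide)
    · exact absurd (D.boundary_simple _ _ _ (D.len_pos _) _ (D.len_pos _)
        ((D.corner .b).symm.trans h)).1 (by decide)
  let x : V → ZMod 2 := fun v => if D.OnSide .r v then 0 else 1
  let y : V → ZMod 2 := Pi.single (D.sideVertex .rb 0) 1
  have hx : ∀ v, D.OnSide .r v → x v = 0 := fun v hv => if_pos hv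
  have hy : ∀ v, D.OnSide .b v → y v = 0 := fun v hv =>
    Pi.single_eq_of_ne (fun h : v = D.sideVertex .rb 0 => hb (h ▸ hv)) 1
  have hxy : ∀ v, D.OnSide .rb v → x v + y v = 1 := fun v hv => by
    by_cases hr : D.OnSide .r v
    · rw [hx v hr, hrr v hv hr]
      simp [y]
    · have hv : v ≠ D.sideVertex .rb 0 := fun h => hr (h ▸ onSide_r_corner)
      simp [x, y, hr, hv]
  refine ⟨D.d (fun v c => Color.rec (x v) 0 (y v) c), ⟨fun c f => ?_, fun i hi => ?_,
    fun i hi => ?_, fun i hi => ?_, fun i hi => ?_⟩, ?_⟩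
  · rw [field_d, curl_d]
  · have h := onSide_ends hi
    simp [d, hx _ h.1, hx _ h.2]
  · have h := onSide_ends hi
    simp [d, hy _ h.1, hy _ h.2]
  · have h := onSide_ends hi
    change (x _ - x _) + (y _ - y _) = 0
    linear_combination hxy _ h.2 - hxy _ h.1
  · exact sub_self (0 : ZMod 2)
  · rw [hol, field_d, sideInt_d]
    change x _ - x _ = 1
    rw [hx _ onSide_r_corner, sub_zero]
    have := hxy _ (onSide_last _)
    rwa [hy _ onSide_b_corner, add_zero] at this

/-! ### The phase of the code states -/

variable (D)

open Classical in
/-- A potential of a cocycle, normalized to vanish at the corner between `L_r` and `L_rb`. -/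
def pot (α : E → ZMod 2) : V → ZMod 2 :=
  if h : ∃ u, D.d u = α ∧ u (D.sideVertex .rb 0) = 0 then h.choose else 0

/-- The exponent `∫ u ∪ a_g ∪ a_b` of the phase of a configuration, where `u` is the potential of
the red field. -/
def action (a : Config E) : ZMod 2 :=
  D.intCup (D.cup01 (D.pot (field .r a)) (field .g a)) (field .b a)

/-- The unit gauge parameter of colour `c` at the vertex `v`. -/
def vtx (c : Color) (v : V) : V → Color → ZMod 2 := Pi.single v (Pi.single c 1)

/-- The exponent of the phase of `S^r_v`. -/
def phaseR (v : V) (a : Config E) : ZMod 2 :=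
  D.intCup (D.cup01 (Pi.single v 1) (field .g a)) (field .b a)

/-- The exponent of the phase of `S^g_v`. -/
def phaseG (v : V) (a : Config E) : ZMod 2 :=
  D.intCup (D.cup10 (field .r a) (Pi.single v 1)) (field .b a)

/-- The exponent of the phase of `S^b_v`. -/
def phaseB (v : V) (a : Config E) : ZMod 2 :=
  D.intCup (field .r a) (D.cup10 (field .g a) (Pi.single v 1))

variable {D}

lemma pot_d {u : V → ZMod 2} (hu : u (D.sideVertex .rb 0) = 0) : D.pot (D.d u) = u := by
  have h : ∃ w, D.d w = D.d u ∧ w (D.sideVertex .rb 0) = 0 := ⟨u, rfl, hu⟩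
  obtain ⟨h1, h2⟩ := h.choose_spec
  rw [pot, dif_pos h]
  have hd : D.d (h.choose - u) = 0 := by
    funext e
    have := congrFun h1 e
    simp only [d, Pi.sub_apply, Pi.zero_apply] at this ⊢
    linear_combination this
  funext v
  have := D.eq_of_d_eq_zero hd v (D.sideVertex .rb 0)
  rw [Pi.sub_apply, Pi.sub_apply, h2, hu, sub_zero] at this
  exact sub_eq_zero.1 this

lemma pot_spec {α : E → ZMod 2} (hα : ∀ f, (D.cell f).curl α = 0) :
    D.d (D.pot α) = α ∧ D.pot α (D.sideVertex .rb 0) = 0 := by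
  obtain ⟨u, rfl, hu⟩ := D.exists_potential hα (D.sideVertex .rb 0)
  rw [pot_d hu]
  exact ⟨rfl, hu⟩

lemma IsAdmissible.pot_eq_zero {a : Config E} (ha : D.IsAdmissible a) {v : V}
    (hv : D.OnSide .r v) : D.pot (field .r a) v = 0 := by
  obtain ⟨h1, h2⟩ := pot_spec (ha.flat .r)
  exact (eq_on_side (fun i hi => by rw [h1]; exact ha.red i hi) hv onSide_r_corner).trans h2

lemma cup01_add_left (u w : V → ZMod 2) (γ : E → ZMod 2) :
    D.cup01 (u + w) γ = D.cup01 u γ + D.cup01 w γ := by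
  funext e
  simp [cup01, add_mul]

lemma cup01_add_right (u : V → ZMod 2) (γ γ' : E → ZMod 2) :
    D.cup01 u (γ + γ') = D.cup01 u γ + D.cup01 u γ' := by
  funext e
  simp [cup01, mul_add]

lemma field_d_vtx (c : Color) (v : V) : field c (D.d (vtx c v)) = D.d (Pi.single v 1) := by
  rw [field_d]
  congr 1
  funext w
  by_cases h : w = v
  · subst h
    simp [vtx]
  · simp [vtx, h]

lemma field_d_vtx_of_ne {c c' : Color} (h : c' ≠ c) (v : V) :
    field c' (D.d (vtx c v)) = 0 := by
  rw [field_d]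
  funext e
  by_cases h1 : D.tgt e = v <;> by_cases h2 : D.src e = v <;>
    simp [vtx, d, h, h1, h2]

lemma action_add_red {a : Config E} (hr : ∀ f, (D.cell f).curl (field .r a) = 0) {v : V}
    (hv : v ≠ D.sideVertex .rb 0) :
    D.action (a + D.d (vtx .r v)) = D.action a + D.phaseR v a := by
  obtain ⟨h1, h2⟩ := pot_spec hr
  have hp : D.pot (field .r a + D.d (Pi.single v 1)) = D.pot (field .r a) + Pi.single v 1 := by
    conv_lhs => rw [← h1, ← d_add]
    rw [pot_d]
    rw [Pi.add_apply, h2, Pi.single_eq_of_ne hv.symm, add_zero]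
  simp only [action, field_add, field_d_vtx, field_d_vtx_of_ne (show Color.g ≠ .r by decide),
    field_d_vtx_of_ne (show Color.b ≠ .r by decide), add_zero, hp, cup01_add_left,
    intCup_add_left, phaseR]

/-- Integration by parts moves the coboundary of `v` off the green slot; the boundary term has
to vanish. -/
lemma action_add_green {a : Config E} (hr : ∀ f, (D.cell f).curl (field .r a) = 0)
    (hb : ∀ f, (D.cell f).curl (field .b a) = 0) {v : V}
    (hv : ∀ A, ∀ i < D.len A, D.src (D.sideEdge A i) = v →
      D.pot (field .r a) v * field .b a (D.sideEdge A i) = 0) :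
    D.action (a + D.d (vtx .g v)) = D.action a + D.phaseG v a := by
  obtain ⟨h1, -⟩ := pot_spec hr
  set u := D.pot (field .r a)
  have hprod : D.cup01 u (D.d (Pi.single v 1)) + D.cup10 (field .r a) (Pi.single v 1) =
      D.d (u * Pi.single v 1) := by
    funext e
    simp only [← h1, cup01, cup10, d, Pi.add_apply, Pi.mul_apply]
    ring
  have hst : D.intCup (D.d (u * Pi.single v 1)) (field .b a) = 0 := by
    rw [intCup, ← Finset.sum_congr rfl fun f _ => D.curl_cup01 _ (hb f), sum_curl]
    refine Finset.sum_eq_zero fun A _ => D.sideInt_eq_zero fun i hi => ?_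
    by_cases h : D.src (D.sideEdge A i) = v
    · simpa [cup01, h] using hv A i hi h
    · simp [cup01, h]
  rw [← hprod, intCup_add_left] at hst
  simp only [action, field_add, field_d_vtx, field_d_vtx_of_ne (show Color.r ≠ .g by decide),
    field_d_vtx_of_ne (show Color.b ≠ .g by decide), add_zero, cup01_add_right,
    intCup_add_left, phaseG]
  rw [CharTwo.add_eq_zero.1 hst]

/-- Integration by parts moves the coboundary of `v` off the blue slot; the boundary term has
to vanish. -/
lemma action_add_blue {a : Config E} (hr : ∀ f, (D.cell f).curl (field .r a) = 0)
    (hg : ∀ f, (D.cell f).curl (field .g a) = 0) {v : V}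
    (hv : ∀ A, ∀ i < D.len A, D.tgt (D.sideEdge A i) = v →
      D.pot (field .r a) (D.src (D.sideEdge A i)) * field .g a (D.sideEdge A i) = 0) :
    D.action (a + D.d (vtx .b v)) = D.action a + D.phaseB v a := by
  obtain ⟨h1, -⟩ := pot_spec hr
  set u := D.pot (field .r a)
  have hst : ∑ f, (D.cell f).curl (D.cup10 (D.cup01 u (field .g a)) (Pi.single v 1)) = 0 := by
    rw [sum_curl]
    refine Finset.sum_eq_zero fun A _ => D.sideInt_eq_zero fun i hi => ?_
    by_cases h : D.tgt (D.sideEdge A i) = v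
    · simpa [cup01, cup10, h] using hv A i hi h
    · simp [cup10, h]
  rw [Finset.sum_congr rfl fun f _ => D.curl_cup01_cup10 _ _ (hg f), h1,
    Finset.sum_sub_distrib] at hst
  simp only [action, field_add, field_d_vtx, field_d_vtx_of_ne (show Color.r ≠ .b by decide),
    field_d_vtx_of_ne (show Color.g ≠ .b by decide), add_zero, intCup_add_right, phaseB]
  exact congrArg _ (sub_eq_zero.1 hst).symm

/-! ### The vertex operators -/

lemma xStar_eq (c : Color) (v : V) : D.xStar c v = xOp (D.d (vtx c v)) := by
  rw [xStar]
  congr 1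
  funext e c'
  have hl := D.no_loop e
  have h11 : (-1 : ZMod 2) = 1 := by decide
  by_cases h1 : D.src e = v
  · have h2 : D.tgt e ≠ v := fun h => hl (h1.trans h.symm)
    by_cases hc : c' = c <;> simp [d, vtx, h1, h2, hc, h11]
  · by_cases h2 : D.tgt e = v <;> by_cases hc : c' = c <;> simp [d, vtx, h1, h2, hc]

lemma starR_apply (v : V) (ψ : Hilb E) (a : Config E) :
    D.starR v ψ (a + D.d (vtx .r v)) = sgn (D.phaseR v a) * ψ a := by
  rw [starR, LinearMap.comp_apply, xStar_eq, xOp_apply_add, diagOp_apply]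
  congr 1
  exact prod_czGate (D.intCupBilin ∘ₗ
    { toFun := D.cup01 (Pi.single v 1)
      map_add' := cup01_add_right _
      map_smul' := fun c γ => by funext e; simp [cup01, mul_left_comm] }) .g .b a

/-- The cup product from the right with a fixed 0-cochain, as a linear map. -/
def cup10Lin (u : V → ZMod 2) : (E → ZMod 2) →ₗ[ZMod 2] (E → ZMod 2) where
  toFun γ := D.cup10 γ u
  map_add' γ γ' := by funext e; simp [cup10, add_mul]
  map_smul' c γ := by funext e; simp [cup10, mul_assoc]

lemma starG_apply (v : V) (ψ : Hilb E) (a : Config E) :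
    D.starG v ψ (a + D.d (vtx .g v)) = sgn (D.phaseG v a) * ψ a := by
  rw [starG, LinearMap.comp_apply, xStar_eq, xOp_apply_add, diagOp_apply]
  congr 1
  exact prod_czGate (D.intCupBilin.flip.compl₂ (D.cup10Lin (Pi.single v 1))) .b .r a

lemma starB_apply (v : V) (ψ : Hilb E) (a : Config E) :
    D.starB v ψ (a + D.d (vtx .b v)) = sgn (D.phaseB v a) * ψ a := by
  rw [starB, LinearMap.comp_apply, xStar_eq, xOp_apply_add, diagOp_apply]
  congr 1
  exact prod_czGate (D.intCupBilin.compl₂ (D.cup10Lin (Pi.single v 1))) .r .g a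

variable (D)

/-- The operator `S` performs the gauge transformation with parameter `l`, with a phase that is
the change of the sign `(-1) ^ action` on admissible configurations. -/
def Implements (S : Hilb E →ₗ[ℂ] Hilb E) (l : V → Color → ZMod 2) : Prop :=
  D.IsGauge l ∧ ∃ ph : Config E → ZMod 2,
    (∀ ψ a, S ψ (a + D.d l) = sgn (ph a) * ψ a) ∧
    ∀ a, D.IsAdmissible a → D.action (a + D.d l) = D.action a + ph a

variable {D}

lemma vtx_of_ne {c : Color} {v w : V} (h : w ≠ v) : vtx c v w = 0 := Pi.single_eq_of_ne h _

lemma vtx_color_of_ne {c c' : Color} (h : c' ≠ c) (v w : V) : vtx c v w c' = 0 := by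
  by_cases hw : w = v
  · subst hw
    simp [vtx, h]
  · rw [vtx_of_ne hw, Pi.zero_apply]

lemma implements_starR {v : V} (h : ¬ D.OnSide .r v) (h' : ¬ D.OnSide .rb v) :
    D.Implements (D.starR v) (vtx .r v) := by
  have hz : ∀ A, ¬ D.OnSide A v → ∀ w, D.OnSide A w → vtx .r v w = 0 := fun A hA w hw =>
    vtx_of_ne fun e => hA (e ▸ hw)
  refine ⟨⟨fun w hw => congrFun (hz _ h w hw) _, fun w _ => vtx_color_of_ne (by decide) _ _,
    fun w hw => by rw [hz _ h' w hw, Pi.zero_apply, Pi.zero_apply],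
    fun w _ => vtx_color_of_ne (by decide) _ _⟩, D.phaseR v, starR_apply v, fun a ha => ?_⟩
  exact action_add_red (ha.flat .r) fun e => h (e ▸ onSide_r_corner)

lemma implements_starG {v : V} (h : ¬ D.OnSide .rb v) :
    D.Implements (D.starG v) (vtx .g v) := by
  refine ⟨⟨fun w _ => vtx_color_of_ne (by decide) _ _, fun w _ => vtx_color_of_ne (by decide) _ _,
    fun w _ => by rw [vtx_color_of_ne (by decide), vtx_color_of_ne (by decide)],
    fun w hw => congrFun (vtx_of_ne fun e : w = v => h (e ▸ hw)) _⟩, D.phaseG v, starG_apply v,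
    fun a ha => ?_⟩
  refine action_add_green (ha.flat .r) (ha.flat .b) fun A i hi hs => ?_
  have hv := (onSide_ends hi).1
  rw [hs] at hv
  cases A with
  | r => rw [ha.pot_eq_zero hv, zero_mul]
  | b => exact mul_eq_zero_of_right _ (ha.blue i hi)
  | rb => exact absurd hv h

/-- The boundary term of a blue gauge transformation away from `L_b` vanishes. -/
lemma IsAdmissible.action_add_blue {a : Config E} (ha : D.IsAdmissible a) {v : V}
    (h : ¬ D.OnSide .b v) : D.action (a + D.d (vtx .b v)) = D.action a + D.phaseB v a := by
  refine TriangleLattice.action_add_blue (ha.flat .r) (ha.flat .g) fun A i hi hs => ?_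
  have hv := onSide_ends hi
  cases A with
  | r => rw [ha.pot_eq_zero hv.1, zero_mul]
  | b => exact absurd (hs ▸ hv.2) h
  | rb => exact mul_eq_zero_of_right _ (ha.green i hi)

lemma implements_starB {v : V} (h : ¬ D.OnSide .b v) (h' : ¬ D.OnSide .rb v) :
    D.Implements (D.starB v) (vtx .b v) := by
  have hz : ∀ A, ¬ D.OnSide A v → ∀ w, D.OnSide A w → vtx .b v w = 0 := fun A hA w hw =>
    vtx_of_ne fun e => hA (e ▸ hw)
  exact ⟨⟨fun w _ => vtx_color_of_ne (by decide) _ _, fun w hw => congrFun (hz _ h w hw) _,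
    fun w hw => by rw [hz _ h' w hw, Pi.zero_apply, Pi.zero_apply],
    fun w _ => vtx_color_of_ne (by decide) _ _⟩, D.phaseB v, starB_apply v,
    fun a ha => ha.action_add_blue h⟩

lemma implements_starRB {v : V} (hr : ¬ D.OnSide .r v) (hb : ¬ D.OnSide .b v) :
    D.Implements (D.starR v ∘ₗ D.starB v) (vtx .b v + vtx .r v) := by
  have hz : ∀ c A, ¬ D.OnSide A v → ∀ w, D.OnSide A w → vtx c v w = 0 := fun c A hA w hw =>
    vtx_of_ne fun e => hA (e ▸ hw)
  refine ⟨⟨fun w hw => ?_, fun w hw => ?_, fun w _ => ?_, fun w _ => ?_⟩,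
    fun a => D.phaseR v (a + D.d (vtx .b v)) + D.phaseB v a, fun ψ a => ?_, fun a ha => ?_⟩
  · rw [Pi.add_apply, hz _ _ hr w hw, hz _ _ hr w hw]
    rfl
  · rw [Pi.add_apply, hz _ _ hb w hw, hz _ _ hb w hw]
    rfl
  · by_cases hw : w = v
    · subst hw
      simp [vtx]
    · simp [vtx, hw]
  · rw [Pi.add_apply, Pi.add_apply, vtx_color_of_ne (by decide), vtx_color_of_ne (by decide),
      add_zero]
  · rw [d_add, ← add_assoc, LinearMap.comp_apply, starR_apply, starB_apply, sgn_add, mul_assoc]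
  · rw [d_add, ← add_assoc, action_add_red _ fun e : v = _ => hr (e ▸ onSide_r_corner),
      ha.action_add_blue hb]
    · ring
    · intro f
      rw [field_add, field_d_vtx_of_ne (by decide), add_zero]
      exact ha.flat .r f

/-! ### The code space -/

/-- An operator that shifts the basis by a coboundary, up to signs, fixes the states that are
equivariant under the shift. -/
lemma apply_eq_self_iff_of_shift {S : Hilb E →ₗ[ℂ] Hilb E} {l : V → Color → ZMod 2}
    {ph : Config E → ZMod 2} (h : ∀ ψ a, S ψ (a + D.d l) = sgn (ph a) * ψ a) (ψ : Hilb E) :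
    S ψ = ψ ↔ ∀ a, ψ (a + D.d l) = sgn (ph a) * ψ a := by
  constructor
  · intro hS a
    rw [← h, hS]
  · intro hψ
    ext a
    have := h ψ (a + D.d l)
    rwa [← hψ, add_assoc, add_self_config, add_zero] at this

variable (D)

open Classical in
/-- The unnormalized logical basis state: the sum of `(-1) ^ action a |a⟩` over the admissible
configurations `a` with holonomy `m`. -/
def state (m : ZMod 2) : Hilb E :=
  WithLp.toLp 2 fun a => if D.IsAdmissible a ∧ D.hol a = m then sgn (D.action a) else 0

variable {D}

lemma state_apply {m : ZMod 2} {a : Config E} (ha : D.IsAdmissible a) :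
    D.state m a = if D.hol a = m then sgn (D.action a) else 0 := by
  simp [state, ha]

lemma state_apply_of_not {m : ZMod 2} {a : Config E} (ha : ¬ D.IsAdmissible a) :
    D.state m a = 0 := by
  simp [state, ha]

lemma Implements.state_eq {S : Hilb E →ₗ[ℂ] Hilb E} {l : V → Color → ZMod 2}
    (h : D.Implements S l) (m : ZMod 2) : S (D.state m) = D.state m := by
  obtain ⟨hl, ph, h1, h2⟩ := h
  rw [apply_eq_self_iff_of_shift h1]
  intro a
  by_cases ha : D.IsAdmissible a
  · rw [state_apply ha, state_apply (hl.admissible_add_iff.2 ha), hol_add, hl.hol_eq_zero,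
      add_zero, h2 a ha, sgn_add]
    split_ifs <;> simp [mul_comm]
  · rw [state_apply_of_not ha, state_apply_of_not (fun h => ha (hl.admissible_add_iff.1 h)),
      mul_zero]

lemma diagOp_eq_self_iff (f : Config E → ℂ) (ψ : Hilb E) :
    diagOp f ψ = ψ ↔ ∀ a, ψ a ≠ 0 → f a = 1 := by
  constructor
  · intro h a ha
    have := congrArg (fun φ : Hilb E => φ a) h
    exact mul_right_cancel₀ ha (this.trans (one_mul _).symm)
  · intro h
    ext a
    rw [diagOp_apply]
    by_cases ha : ψ a = 0
    · rw [ha, mul_zero]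
    · rw [h a ha, one_mul]

lemma prod_zGate_edges (c : Color) (f : F) (a : Config E) :
    (((D.cell f).edges.map (zGate c)).prod) a = sgn ((D.cell f).curl (field c a)) := by
  rw [Cell.curl_eq_sum_edges]
  induction (D.cell f).edges with
  | nil => simp
  | cons e l ih =>
    rw [List.map_cons, List.prod_cons, Pi.mul_apply, ih, List.map_cons, List.sum_cons, sgn_add]
    rfl

lemma zGate_eq_one_iff (c : Color) (e : E) (a : Config E) : zGate c e a = 1 ↔ a e c = 0 :=
  sgn_eq_one_iff (x := a e c)

lemma zGate_mul_eq_one_iff (c c' : Color) (e : E) (a : Config E) :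
    (zGate c e * zGate c' e) a = 1 ↔ a e c + a e c' = 0 := by
  rw [← sgn_eq_one_iff, sgn_add]
  rfl

/-- The states of the code are supported on admissible configurations. -/
lemma isAdmissible_of_ne_zero {ψ : Hilb E} (hψ : ψ ∈ D.codeSpace) {a : Config E}
    (ha : ψ a ≠ 0) : D.IsAdmissible a where
  flat c f := by
    rw [← sgn_eq_one_iff, ← prod_zGate_edges]
    exact (diagOp_eq_self_iff _ ψ).1 (hψ _ (.face c f)) a ha
  red i hi := (zGate_eq_one_iff _ _ _).1 <|
    (diagOp_eq_self_iff _ ψ).1 (hψ _ (.side_r i hi)) a ha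
  blue i hi := (zGate_eq_one_iff _ _ _).1 <|
    (diagOp_eq_self_iff _ ψ).1 (hψ _ (.side_b i hi)) a ha
  mixed i hi := (zGate_mul_eq_one_iff _ _ _ _).1 <|
    (diagOp_eq_self_iff _ ψ).1 (hψ _ (.side_rb i hi)) a ha
  green i hi := (zGate_eq_one_iff _ _ _).1 <|
    (diagOp_eq_self_iff _ ψ).1 (hψ _ (.side_rb_green i hi)) a ha

lemma state_mem (m : ZMod 2) : D.state m ∈ D.codeSpace := by
  have hne : ∀ a, D.state m a ≠ 0 → D.IsAdmissible a := fun a ha => by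
    by_contra h
    exact ha (state_apply_of_not h)
  intro S hS
  cases hS with
  | face c f =>
    refine (diagOp_eq_self_iff _ _).2 fun a ha => ?_
    rw [prod_zGate_edges, (hne a ha).flat, sgn_zero]
  | side_r i hi =>
    exact (diagOp_eq_self_iff _ _).2 fun a ha => (zGate_eq_one_iff _ _ _).2 ((hne a ha).red i hi)
  | side_b i hi =>
    exact (diagOp_eq_self_iff _ _).2 fun a ha => (zGate_eq_one_iff _ _ _).2 ((hne a ha).blue i hi)
  | side_rb i hi =>
    exact (diagOp_eq_self_iff _ _).2 fun a ha =>
      (zGate_mul_eq_one_iff _ _ _ _).2 ((hne a ha).mixed i hi)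
  | side_rb_green i hi =>
    exact (diagOp_eq_self_iff _ _).2 fun a ha =>
      (zGate_eq_one_iff _ _ _).2 ((hne a ha).green i hi)
  | star_r v h h' => exact (implements_starR h h').state_eq m
  | star_g v h => exact (implements_starG h).state_eq m
  | star_b v h h' => exact (implements_starB h h').state_eq m
  | star_rb v h hr hb => exact (implements_starRB hr hb).state_eq m

variable (D) in
/-- The shifts of admissible configurations under which `(-1) ^ action • ψ` is invariant. -/
def IsInvariance (ψ : Hilb E) (t : Config E) : Prop :=
  ∀ a, D.IsAdmissible a → D.IsAdmissible (a + t) ∧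
    sgn (D.action (a + t)) * ψ (a + t) = sgn (D.action a) * ψ a

lemma isInvariance_zero (ψ : Hilb E) : D.IsInvariance ψ 0 := fun a ha => by
  rw [add_zero]
  exact ⟨ha, rfl⟩

lemma IsInvariance.add {ψ : Hilb E} {s t : Config E} (hs : D.IsInvariance ψ s)
    (ht : D.IsInvariance ψ t) : D.IsInvariance ψ (s + t) := fun a ha => by
  obtain ⟨h1, h2⟩ := hs a ha
  obtain ⟨h3, h4⟩ := ht _ h1
  rw [← add_assoc]
  exact ⟨h3, h4.trans h2⟩

lemma Implements.isInvariance {S : Hilb E →ₗ[ℂ] Hilb E} {l : V → Color → ZMod 2}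
    (h : D.Implements S l) {ψ : Hilb E} (hψ : S ψ = ψ) : D.IsInvariance ψ (D.d l) := by
  obtain ⟨hl, ph, h1, h2⟩ := h
  intro a ha
  refine ⟨hl.admissible_add_iff.2 ha, ?_⟩
  rw [h2 a ha, (apply_eq_self_iff_of_shift h1 ψ).1 hψ a, sgn_add]
  linear_combination sgn (D.action a) * ψ a * sgn_mul_self (ph a)

/-- Every gauge transformation is a product of those performed by the vertex operators. -/
lemma IsGauge.isInvariance {l : V → Color → ZMod 2} (hl : D.IsGauge l) {ψ : Hilb E}
    (hψ : ψ ∈ D.codeSpace) : D.IsInvariance ψ (D.d l) := by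
  have h01 : ∀ x : ZMod 2, x = 0 ∨ x = 1 := by decide
  have hz : D.d (0 : V → Color → ZMod 2) = 0 := funext fun e => sub_self _
  have hsplit : ∀ v, (Pi.single v (l v) : V → Color → ZMod 2) =
      l v .r • vtx .r v + l v .g • vtx .g v + l v .b • vtx .b v := by
    intro v
    funext w c
    by_cases hw : w = v
    · subst hw
      cases c <;> simp [vtx]
    · simp [vtx, hw]
  have hv : ∀ v, D.IsInvariance ψ (D.d (Pi.single v (l v))) := by
    intro v
    rw [hsplit]
    by_cases hrb : D.OnSide .rb v
    · rw [hl.green v hrb, zero_smul, add_zero, ← hl.mixed v hrb]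
      rcases h01 (l v .r) with h | h
      · rw [h, zero_smul, zero_smul, add_zero, hz]
        exact isInvariance_zero ψ
      · have hr : ¬ D.OnSide .r v := fun hr => zero_ne_one ((hl.red v hr).symm.trans h)
        have hb : ¬ D.OnSide .b v := fun hb =>
          zero_ne_one ((hl.blue v hb).symm.trans ((hl.mixed v hrb).symm.trans h))
        rw [h, one_smul, one_smul, add_comm]
        exact (implements_starRB hr hb).isInvariance (hψ _ (.star_rb v hrb hr hb))
    · rw [d_add, d_add]
      refine IsInvariance.add (IsInvariance.add ?_ ?_) ?_
      · rcases h01 (l v .r) with h | h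
        · rw [h, zero_smul, hz]
          exact isInvariance_zero ψ
        · have hr : ¬ D.OnSide .r v := fun hr => zero_ne_one ((hl.red v hr).symm.trans h)
          rw [h, one_smul]
          exact (implements_starR hr hrb).isInvariance (hψ _ (.star_r v hr hrb))
      · rcases h01 (l v .g) with h | h
        · rw [h, zero_smul, hz]
          exact isInvariance_zero ψ
        · rw [h, one_smul]
          exact (implements_starG hrb).isInvariance (hψ _ (.star_g v hrb))
      · rcases h01 (l v .b) with h | h
        · rw [h, zero_smul, hz]
          exact isInvariance_zero ψ
        · have hb : ¬ D.OnSide .b v := fun hb => zero_ne_one ((hl.blue v hb).symm.trans h)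
          rw [h, one_smul]
          exact (implements_starB hb hrb).isInvariance (hψ _ (.star_b v hb hrb))
  have hsum : ∀ s : Finset V, D.IsInvariance ψ (D.d (∑ v ∈ s, Pi.single v (l v))) := by
    intro s
    induction s using Finset.induction_on with
    | empty =>
      rw [Finset.sum_empty, hz]
      exact isInvariance_zero ψ
    | insert v s hvs ih =>
      rw [Finset.sum_insert hvs, d_add]
      exact (hv v).add ih
  have := hsum Finset.univ
  rwa [Finset.univ_sum_single] at this

/-- Since gauge transformations act transitively on the admissible configurations with given
holonomy, the two basis states span the code space. -/
lemma exists_coeff {ψ : Hilb E} (hψ : ψ ∈ D.codeSpace) :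
    ∃ c : ZMod 2 → ℂ, ψ = c 0 • D.state 0 + c 1 • D.state 1 := by
  choose b hb hbm using D.exists_admissible
  refine ⟨fun m => sgn (D.action (b m)) * ψ (b m), ?_⟩
  ext a
  simp only [PiLp.add_apply, PiLp.smul_apply, smul_eq_mul]
  by_cases ha : D.IsAdmissible a
  · have key : ψ a = sgn (D.action (b (D.hol a))) * ψ (b (D.hol a)) * sgn (D.action a) := by
      have h0 : D.hol (a + b (D.hol a)) = 0 := by
        rw [hol_add, hbm, CharTwo.add_self_eq_zero]
      obtain ⟨l, hl, h⟩ := (ha.add (hb (D.hol a))).exists_gauge h0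
      have h1 := (hl.isInvariance hψ a ha).2
      rw [← h, ← add_assoc, add_self_config, zero_add] at h1
      rw [h1]
      linear_combination - ψ a * sgn_mul_self (D.action a)
    have h01 : D.hol a = 0 ∨ D.hol a = 1 := (by decide : ∀ x : ZMod 2, x = 0 ∨ x = 1) _
    rcases h01 with h | h <;> rw [h] at key <;> rw [key] <;> simp [state_apply ha, h]
  · have hz : ψ a = 0 := by
      by_contra h
      exact ha (isAdmissible_of_ne_zero hψ h)
    rw [hz, state_apply_of_not ha, state_apply_of_not ha]
    simp

end TriangleLattice

/-! ### Eighth roots of unity and integral lifts -/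

/-- The power `exp (π i / 4) ^ n`. -/
def eighth (n : ℤ) : ℂ := Complex.exp (Real.pi * Complex.I / 4) ^ n

lemma eighth_add (m n : ℤ) : eighth (m + n) = eighth m * eighth n :=
  zpow_add₀ (Complex.exp_ne_zero _) m n

lemma eighth_mul (m n : ℤ) : eighth (m * n) = eighth m ^ n := zpow_mul _ m n

@[simp] lemma eighth_zero : eighth 0 = 1 := zpow_zero _

lemma eighth_neg (n : ℤ) : eighth (-n) = (eighth n)⁻¹ := zpow_neg _ n

lemma eighth_eq_exp (n : ℤ) : eighth n = Complex.exp (n * (Real.pi * Complex.I / 4)) :=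
  (Complex.exp_int_mul _ n).symm

lemma eighth_two : eighth 2 = Complex.I := by
  rw [eighth_eq_exp]
  refine (congrArg Complex.exp ?_).trans Complex.exp_pi_div_two_mul_I
  push_cast
  ring

lemma eighth_four : eighth 4 = -1 := by
  rw [show (4 : ℤ) = 2 + 2 by norm_num, eighth_add, eighth_two, Complex.I_mul_I]

lemma eighth_of_dvd {n : ℤ} (h : 8 ∣ n) : eighth n = 1 := by
  obtain ⟨k, rfl⟩ := h
  rw [eighth_mul, show (8 : ℤ) = 4 + 4 by norm_num, eighth_add, eighth_four]
  norm_num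

lemma norm_eighth (n : ℤ) : ‖eighth n‖ = 1 := by
  rw [eighth_eq_exp, show (n : ℂ) * (Real.pi * Complex.I / 4) =
    ((n * Real.pi / 4 : ℝ) : ℂ) * Complex.I by push_cast; ring]
  exact Complex.norm_exp_ofReal_mul_I _

lemma eighth_sum {ι : Type*} (s : Finset ι) (f : ι → ℤ) :
    eighth (∑ i ∈ s, f i) = ∏ i ∈ s, eighth (f i) := by
  classical
  induction s using Finset.induction_on with
  | empty => simp
  | insert i s hi ih => rw [Finset.sum_insert hi, Finset.prod_insert hi, eighth_add, ih]

lemma sgn_intCast (n : ℤ) : sgn (n : ZMod 2) = eighth (4 * n) := by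
  have h2 : ((2 : ℤ) : ZMod 2) = 0 := by decide
  obtain ⟨k, rfl | rfl⟩ := Int.even_or_odd' n
  · rw [eighth_of_dvd ⟨k, by ring⟩, Int.cast_mul, h2, zero_mul, sgn_zero]
  · rw [mul_add, eighth_add, eighth_of_dvd ⟨k, by ring⟩, Int.cast_add, Int.cast_mul, h2, zero_mul,
      zero_add, Int.cast_one, sgn_one, mul_one, eighth_four, one_mul]

/-- The lift of a `ZMod 2`-valued cochain to an integral cochain with values `0` and `1`. -/
def lift {X : Type*} (α : X → ZMod 2) : X → ℤ := fun x => (α x).val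

lemma lift_cast {X : Type*} (α : X → ZMod 2) (x : X) : ((lift α x : ℤ) : ZMod 2) = α x := by
  simp [lift]

lemma csGate_eq {E : Type*} (e e' : E) (a : Config E) :
    csGate .r .b e e' a = eighth (2 * (lift (field .r a) e * lift (field .b a) e')) := by
  have h : ∀ x y : ZMod 2,
      (x = 1 ∧ y = 1 ∧ (x.val : ℤ) * y.val = 1) ∨
        (¬ (x = 1 ∧ y = 1) ∧ (x.val : ℤ) * y.val = 0) := by
    decide
  rcases h (a e .r) (a e' .b) with ⟨h1, h2, h3⟩ | ⟨h1, h3⟩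
  · rw [csGate, if_pos ⟨h1, h2⟩]
    simp only [lift, field, h3, mul_one, eighth_two]
  · rw [csGate, if_neg h1]
    simp only [lift, field, h3, mul_zero, eighth_zero]

lemma tGate_eq {E : Type*} (e : E) (a : Config E) :
    tGate .r e a = eighth (lift (field .r a) e) := by
  have h : ∀ x : ZMod 2, (x = 1 ∧ (x.val : ℤ) = 1) ∨ (x ≠ 1 ∧ (x.val : ℤ) = 0) := by decide
  rcases h (a e .r) with ⟨h1, h2⟩ | ⟨h1, h2⟩
  · rw [tGate, if_pos h1]
    simp only [lift, field, h2, eighth, zpow_one]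
  · rw [tGate, if_neg h1]
    simp only [lift, field, h2, eighth_zero]

lemma csGates_eq {E : Type*} (K : Cell E) (a : Config E) :
    K.csGates a = eighth (2 * K.cup (lift (field .r a)) (lift (field .b a))) := by
  cases K with
  | triangle σ e01 e12 e02 =>
    simp only [Cell.csGates, Cell.cup, Pi.pow_apply, csGate_eq, ← eighth_mul]
    congr 1
    simp only [Int.cast_eq]
    ring
  | square σ e01 e13 e02 e23 =>
    simp only [Cell.csGates, Cell.cup, Pi.pow_apply, Pi.mul_apply, Pi.inv_apply, csGate_eq,
      ← eighth_neg, ← eighth_add, ← eighth_mul]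
    congr 1
    simp only [Int.cast_eq]
    ring

namespace TriangleLattice

variable {V E F : Type*} [Fintype V] [Fintype E] [Fintype F] [DecidableEq V] [DecidableEq E]
  {D : TriangleLattice V E F}

/-! ### The cup product of integral lifts -/

/-- Modulo `4` the lifts of `d u` and of a cocycle `β` satisfy
`A ∪ B + 2 U ∪ (A + B) ∪ B = d (U ∪ B)`. -/
lemma four_dvd_cup (u : V → ZMod 2) {β : E → ZMod 2} {f : F} (hβ : (D.cell f).curl β = 0) :
    4 ∣ (D.cell f).cup (lift (D.d u)) (lift β) +
      2 * (D.cell f).cup (D.cup01 (lift u) (lift (D.d u) + lift β)) (lift β) -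
      (D.cell f).curl (D.cup01 (lift u) (lift β)) := by
  have h := D.wellFormed f
  generalize D.cell f = K at h hβ ⊢
  rw [Cell.curl_eq_sum_edges] at hβ
  rcases K with ⟨σ, e01, e12, e02⟩ | ⟨σ, e01, e13, e02, e23⟩
  · obtain ⟨h1, h2, h3⟩ := h
    have key : ∀ x0 x1 b01 b12 b02 : ZMod 2, b01 + (b12 + (b02 + 0)) = 0 →
        (4 : ℤ) ∣ (x1 - x0).val * b12.val +
          2 * (x0.val * ((x1 - x0).val + b01.val) * b12.val) -
          (x0.val * b01.val + x1.val * b12.val - x0.val * b02.val) := by decide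
    have hk := key (u (D.src e01)) (u (D.tgt e01)) _ _ _ hβ
    refine (hk.mul_left σ).trans (dvd_of_eq ?_)
    simp only [Cell.curl, Cell.cup, cup01, lift, d, Pi.add_apply, ← h1, ← h2, Int.cast_eq]
    ring
  · obtain ⟨h1, h2, h3, h4, -, -⟩ := h
    have key : ∀ x0 x1 x2 b01 b13 b02 b23 : ZMod 2, b01 + (b13 + (b02 + (b23 + 0))) = 0 →
        (4 : ℤ) ∣ (x1 - x0).val * b13.val - (x2 - x0).val * b23.val +
          2 * (x0.val * ((x1 - x0).val + b01.val) * b13.val -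
            x0.val * ((x2 - x0).val + b02.val) * b23.val) -
          (x0.val * b01.val + x1.val * b13.val - x0.val * b02.val - x2.val * b23.val) := by
      decide
    have hk := key (u (D.src e01)) (u (D.tgt e01)) (u (D.tgt e02)) _ _ _ _ hβ
    refine (hk.mul_left σ).trans (dvd_of_eq ?_)
    simp only [Cell.curl, Cell.cup, cup01, lift, d, Pi.add_apply, ← h1, ← h2, ← h3, Int.cast_eq]
    ring

/-- The exponent of the phase of `U` on the code: the bulk terms reduce to an integral over
`L_rb`, which together with the `T†` gates is a total differential. -/
lemma IsAdmissible.eight_dvd {a : Config E} (ha : D.IsAdmissible a) :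
    8 ∣ 2 * D.intCup (lift (field .r a)) (lift (field .b a)) - D.sideInt .rb (lift (field .r a)) +
      4 * D.intCup (D.cup01 (lift (D.pot (field .r a)))
        (lift (field .r a) + lift (field .b a))) (lift (field .b a)) + (D.hol a).val := by
  obtain ⟨h1, h2⟩ := pot_spec (ha.flat .r)
  have hr : ∀ v, D.OnSide .r v → D.pot (field .r a) v = 0 := fun v => ha.pot_eq_zero
  have hrb : ∀ i < D.len .rb,
      field .b a (D.sideEdge .rb i) = field .r a (D.sideEdge .rb i) := fun i hi =>
    (CharTwo.add_eq_zero.1 (ha.mixed i hi)).symm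
  have hhol : D.hol a = D.pot (field .r a) (D.sideVertex .rb (D.len .rb)) := by
    rw [hol, ← h1, sideInt_d, h1, h2, sub_zero]
  set u := D.pot (field .r a)
  have hbulk : 4 ∣ D.intCup (lift (field .r a)) (lift (field .b a)) +
      2 * D.intCup (D.cup01 (lift u) (lift (field .r a) + lift (field .b a)))
        (lift (field .b a)) - D.sideInt .rb (D.cup01 (lift u) (lift (field .b a))) := by
    have hst : ∑ f, (D.cell f).curl (D.cup01 (lift u) (lift (field .b a))) =
        D.sideInt .rb (D.cup01 (lift u) (lift (field .b a))) := by
      rw [sum_curl, Finset.sum_eq_single Side.rb]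
      · rintro (_ | _ | _) _ hA
        · refine D.sideInt_eq_zero fun i hi => ?_
          simp [cup01, lift, hr _ (onSide_ends hi).1]
        · refine D.sideInt_eq_zero fun i hi => ?_
          simp [cup01, lift, field, ha.blue i hi]
        · exact absurd rfl hA
      · simp
    rw [← hst, intCup, intCup, Finset.mul_sum, ← Finset.sum_add_distrib,
      ← Finset.sum_sub_distrib]
    refine Finset.dvd_sum fun f _ => ?_
    have := four_dvd_cup u (ha.flat .b f)
    rwa [h1] at this
  have hside : 2 * D.sideInt .rb (D.cup01 (lift u) (lift (field .b a))) -
      D.sideInt .rb (lift (field .r a)) = - ((D.hol a).val : ℤ) := by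
    have hd : D.sideInt .rb (D.d (lift u)) = (D.hol a).val := by
      rw [sideInt_d, hhol]
      simp [lift, h2]
    rw [← hd]
    simp only [sideInt, Finset.mul_sum, ← Finset.sum_sub_distrib, ← Finset.sum_neg_distrib]
    refine Finset.sum_congr rfl fun i hi => ?_
    have key : ∀ x0 x1 : ZMod 2,
        2 * ((x0.val : ℤ) * (x1 - x0).val) - (x1 - x0).val = - (x1.val - x0.val) := by decide
    have hk := key (u (D.src (D.sideEdge .rb i))) (u (D.tgt (D.sideEdge .rb i)))
    have he := congrFun h1 (D.sideEdge .rb i)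
    simp only [d] at he
    rw [he] at hk
    simp only [cup01, lift, d, hrb i (Finset.mem_range.1 hi), Int.cast_eq]
    linear_combination (D.sideSign .rb i : ℤ) * hk
  obtain ⟨k, hk⟩ := hbulk
  exact ⟨k, by linear_combination 2 * hk + hside⟩

/-! ### The operator `U` on the code -/

/-- The basis permutation underlying `V`: it adds the red and the blue field to the green one. -/
def mix (a : Config E) : Config E :=
  fun e => Function.update (a e) .g (a e .g + a e .r + a e .b)

lemma opV_apply (ψ : Hilb E) (a : Config E) : D.opV ψ a = ψ (mix a) := by
  rw [opV, permOp_apply]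
  refine congrArg (fun b : Config E => ψ b) ?_
  funext e c
  -- both `CNOT`s are involutions, so the inverse permutation is applied by the same formulas
  change (fun s : Color → ZMod 2 => Function.update s .g (s .g + s .b))
    (Function.update (a e) .g (a e .g + a e .r)) c = _
  cases c <;> simp [mix]

lemma field_r_mix (a : Config E) : field .r (mix a) = field .r a := by
  funext e
  simp [field, mix]

lemma field_b_mix (a : Config E) : field .b (mix a) = field .b a := by
  funext e
  simp [field, mix]

lemma field_g_mix (a : Config E) :
    field .g (mix a) = field .g a + (field .r a + field .b a) := by
  funext e
  simp [field, mix, add_assoc]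

lemma mix_mix (a : Config E) : mix (mix a) = a := by
  funext e c
  have h : ∀ x y z : ZMod 2, x + y + z + y + z = x := by decide
  cases c <;> simp [mix, h]

lemma IsAdmissible.mix {a : Config E} (ha : D.IsAdmissible a) : D.IsAdmissible (mix a) where
  flat c f := by
    cases c
    · rw [field_r_mix, ha.flat]
    · rw [field_g_mix, Cell.curl_add, Cell.curl_add, ha.flat, ha.flat, ha.flat]
      rfl
    · rw [field_b_mix, ha.flat]
  red i hi := (congrFun (field_r_mix a) _).trans (ha.red i hi)
  blue i hi := (congrFun (field_b_mix a) _).trans (ha.blue i hi)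
  mixed i hi := (congrArg₂ (· + ·) (congrFun (field_r_mix a) _)
    (congrFun (field_b_mix a) _)).trans (ha.mixed i hi)
  green i hi := (congrFun (field_g_mix a) _).trans
    ((congrArg₂ (· + ·) (ha.green i hi) (ha.mixed i hi)).trans (add_zero 0))

lemma isAdmissible_mix_iff {a : Config E} : D.IsAdmissible (mix a) ↔ D.IsAdmissible a :=
  ⟨fun h => mix_mix a ▸ h.mix, IsAdmissible.mix⟩

lemma intCast_intCup (α β : E → ℤ) :
    ((D.intCup α β : ℤ) : ZMod 2) =
      D.intCup (fun e => (α e : ZMod 2)) (fun e => (β e : ZMod 2)) := by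
  rw [intCup, intCup, Int.cast_sum]
  refine Finset.sum_congr rfl fun f _ => ?_
  cases D.cell f <;> simp [Cell.cup]

lemma action_mix (a : Config E) :
    D.action (mix a) = D.action a +
      ((D.intCup (D.cup01 (lift (D.pot (field .r a))) (lift (field .r a) + lift (field .b a)))
        (lift (field .b a)) : ℤ) : ZMod 2) := by
  rw [intCast_intCup, action, action, field_r_mix, field_g_mix, field_b_mix, cup01_add_right,
    intCup_add_left]
  simp only [cup01, Int.cast_mul, Pi.add_apply, Int.cast_add, lift_cast]
  rfl

variable (D) in
/-- The exponent of the phase of `W`, in units of `π / 4`. -/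
def phaseW (a : Config E) : ℤ :=
  2 * D.intCup (lift (field .r a)) (lift (field .b a)) - D.sideInt .rb (lift (field .r a))

lemma opW_eq : D.opW = diagOp fun a => eighth (D.phaseW a) := by
  rw [opW]
  congr 1
  funext a
  rw [Pi.mul_apply, Finset.prod_apply, Finset.prod_apply, phaseW, sub_eq_add_neg, eighth_add,
    intCup, Finset.mul_sum, eighth_sum, sideInt, ← Finset.sum_neg_distrib, eighth_sum]
  congr 1
  · exact Finset.prod_congr rfl fun f _ => csGates_eq _ a
  · refine Finset.prod_congr rfl fun i _ => ?_
    rw [Pi.inv_apply, Pi.pow_apply, tGate_eq, ← eighth_mul, eighth_neg, Int.cast_id, mul_comm]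

lemma opU_state (m : ZMod 2) : D.opU (D.state m) = eighth (-(m.val : ℤ)) • D.state m := by
  ext a
  rw [opU, LinearMap.comp_apply, opW_eq, diagOp_apply, opV_apply, PiLp.smul_apply, smul_eq_mul]
  by_cases ha : D.IsAdmissible a
  · have hh : D.hol (mix a) = D.hol a := by rw [hol, field_r_mix, hol]
    rw [state_apply ha, state_apply ha.mix, hh]
    split_ifs with hm
    · subst hm
      rw [action_mix, sgn_add, sgn_intCast, mul_left_comm, ← eighth_add, mul_comm]
      congr 1
      have h := eighth_of_dvd ha.eight_dvd
      rw [eighth_add] at h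
      rw [eighth_neg]
      exact eq_inv_of_mul_eq_one_left h
    · simp
  · rw [state_apply_of_not ha, state_apply_of_not (fun h => ha (isAdmissible_mix_iff.1 h))]
    simp

lemma logicalZ_state (m : ZMod 2) : D.logicalZ (D.state m) = sgn m • D.state m := by
  ext a
  rw [logicalZ, diagOp_apply, PiLp.smul_apply, smul_eq_mul]
  by_cases ha : D.IsAdmissible a
  · rw [state_apply ha]
    split_ifs with hm
    · congr 1
      rw [← hm, hol, sideInt, sgn_sum, Finset.prod_apply]
      refine Finset.prod_congr rfl fun i _ => ?_
      rw [Cell.cast_units, one_mul]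
      rfl
    · simp
  · rw [state_apply_of_not ha]
    simp

lemma opU_mem_unitary : D.opU ∈ unitary (Hilb E →ₗ[ℂ] Hilb E) := by
  have hW : D.opW ∈ unitary (Hilb E →ₗ[ℂ] Hilb E) := by
    rw [opW_eq]
    exact diagOp_mem_unitary _ fun a => norm_eighth _
  exact mul_mem hW (permOp_mem_unitary _)

lemma map_opU_codeSpace : D.codeSpace.map D.opU = D.codeSpace := by
  have hU : ∀ c : ZMod 2 → ℂ, D.opU (c 0 • D.state 0 + c 1 • D.state 1) =
      c 0 • D.state 0 + (c 1 * eighth (-1)) • D.state 1 := fun c => by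
    rw [map_add, map_smul, map_smul, opU_state, opU_state]
    simp [ZMod.val_one, smul_smul]
  refine le_antisymm ?_ fun ψ hψ => ?_
  · rintro _ ⟨ψ, hψ, rfl⟩
    obtain ⟨c, rfl⟩ := exists_coeff hψ
    rw [hU]
    exact add_mem (Submodule.smul_mem _ _ (state_mem 0)) (Submodule.smul_mem _ _ (state_mem 1))
  · obtain ⟨c, rfl⟩ := exists_coeff hψ
    refine ⟨c 0 • D.state 0 + (c 1 * eighth 1) • D.state 1, add_mem
      (Submodule.smul_mem _ _ (state_mem 0)) (Submodule.smul_mem _ _ (state_mem 1)), ?_⟩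
    have h := hU fun m => if m = 0 then c 0 else c 1 * eighth 1
    simp only [if_true, one_ne_zero, if_false] at h
    rw [h, mul_assoc, ← eighth_add]
    simp

lemma state_ne_zero (m : ZMod 2) : D.state m ≠ 0 := by
  obtain ⟨a, ha, hm⟩ := D.exists_admissible m
  intro h
  have h1 : D.state m a = 0 := by rw [h]; rfl
  rw [state_apply ha, if_pos hm] at h1
  have := norm_sgn (D.action a)
  rw [h1, norm_zero] at this
  exact zero_ne_one this

lemma inner_state_of_ne {m n : ZMod 2} (h : m ≠ n) : inner ℂ (D.state m) (D.state n) = 0 := by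
  rw [PiLp.inner_apply]
  refine Finset.sum_eq_zero fun a _ => ?_
  by_cases ha : D.IsAdmissible a
  · rw [state_apply ha, state_apply ha]
    by_cases hm : D.hol a = m
    · rw [if_neg (fun hn => h (hm.symm.trans hn)), inner_zero_right]
    · rw [if_neg hm, inner_zero_left]
  · rw [state_apply_of_not ha, inner_zero_left]

variable (D) in
/-- The normalized logical basis states. -/
def ket (m : Fin 2) : D.codeSpace :=
  ⟨((‖D.state ((m : ℕ) : ZMod 2)‖⁻¹ : ℝ) : ℂ) • D.state ((m : ℕ) : ZMod 2),
    Submodule.smul_mem _ _ (state_mem _)⟩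

lemma orthonormal_ket : Orthonormal ℂ D.ket := by
  constructor
  · intro m
    have h := norm_ne_zero_iff.2 (D.state_ne_zero ((m : ℕ) : ZMod 2))
    rw [ket, Submodule.coe_norm, norm_smul, Complex.norm_real, norm_inv, norm_norm,
      inv_mul_cancel₀ h]
  · intro m n hmn
    have h : ((m : ℕ) : ZMod 2) ≠ ((n : ℕ) : ZMod 2) := by
      revert m n
      decide
    rw [Submodule.coe_inner]
    simp only [ket, inner_smul_left, inner_smul_right, inner_state_of_ne h, mul_zero]

lemma span_ket : ⊤ ≤ Submodule.span ℂ (Set.range D.ket) := by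
  have hmem : ∀ (m : Fin 2) (h : D.state ((m : ℕ) : ZMod 2) ∈ D.codeSpace),
      (⟨_, h⟩ : D.codeSpace) ∈ Submodule.span ℂ (Set.range D.ket) := by
    intro m h
    have hn : (‖D.state ((m : ℕ) : ZMod 2)‖ : ℂ) ≠ 0 :=
      Complex.ofReal_ne_zero.2 (norm_ne_zero_iff.2 (D.state_ne_zero _))
    have := Submodule.smul_mem _ (‖D.state ((m : ℕ) : ZMod 2)‖ : ℂ)
      (Submodule.subset_span (R := ℂ) (Set.mem_range_self (f := D.ket) m))
    convert this using 1
    refine Subtype.ext ?_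
    rw [ket, Submodule.coe_smul, smul_smul, Complex.ofReal_inv, mul_inv_cancel₀ hn, one_smul]
  rintro ⟨ψ, hψ⟩ -
  obtain ⟨c, rfl⟩ := exists_coeff hψ
  have h0 := hmem 0 (state_mem _)
  have h1 := hmem 1 (state_mem _)
  simp only [Fin.val_zero, Fin.val_one, Nat.cast_zero, Nat.cast_one] at h0 h1
  exact add_mem (Submodule.smul_mem _ (c 0) h0) (Submodule.smul_mem _ (c 1) h1)

end TriangleLattice

end

end CliffordCode

theorem theorem2 {V E F : Type*} [Fintype V] [Fintype E] [Fintype F]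
    [DecidableEq V] [DecidableEq E] (D : CliffordCode.TriangleLattice V E F) :
    D.opU ∈ unitary (CliffordCode.Hilb E →ₗ[ℂ] CliffordCode.Hilb E) ∧
    D.codeSpace.map D.opU = D.codeSpace ∧
    ∃ ket : OrthonormalBasis (Fin 2) ℂ D.codeSpace, ∀ m : Fin 2,
      D.logicalZ (ket m) = (-1 : ℂ) ^ (m : ℕ) • (ket m : CliffordCode.Hilb E) ∧
      D.opU (ket m) =
        Complex.exp (-(Real.pi * Complex.I * (m : ℕ) / 4)) • (ket m : CliffordCode.Hilb E) := by
  open CliffordCode TriangleLattice in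
  refine ⟨opU_mem_unitary, map_opU_codeSpace,
    OrthonormalBasis.mk orthonormal_ket span_ket, fun m => ?_⟩
  rw [OrthonormalBasis.coe_mk]
  have hs : CliffordCode.sgn ((m : ℕ) : ZMod 2) = (-1 : ℂ) ^ (m : ℕ) := by
    fin_cases m <;> simp [CliffordCode.sgn_one]
  have he : CliffordCode.eighth (-((((m : ℕ) : ZMod 2).val : ℕ) : ℤ)) =
      Complex.exp (-(Real.pi * Complex.I * (m : ℕ) / 4)) := by
    have hv : (((m : ℕ) : ZMod 2).val) = (m : ℕ) := ZMod.val_cast_of_lt m.isLt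
    rw [hv, CliffordCode.eighth_eq_exp]
    congr 1
    push_cast
    ring
  constructor
  · rw [CliffordCode.TriangleLattice.ket, map_smul, CliffordCode.TriangleLattice.logicalZ_state,
      hs, smul_comm]
  · rw [CliffordCode.TriangleLattice.ket, map_smul, CliffordCode.TriangleLattice.opU_state, he,
      smul_comm]
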